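/- Let $\hat K=\{(\xi,\eta,\zeta): 0\le\zeta\le 1,\ 0\le\xi,\eta\le 1-\zeta\}$ be the reference pyramid, $K_\infty=\{(x,y,z): 0\le x,y\le 1,\ z\ge 0\}$ the infinite pyramid, and $\phi:K_\infty\to\hat K$, $\phi(x,y,z)=\left(\frac{x}{1+z},\frac{y}{1+z},\frac{z}{1+z}\right)$. An affine pyramid is $K=\phi_K(\hat K)$ with $\phi_K:\mathbb R^3\to\mathbb R^3$ an invertible affine map; $|D\phi_K|$ is the absolute value of its Jacobian determinant. All fields below are considered in the interiors of these sets. For $s\in\{0,1,2,3\}$, an $s$-form is given by its proxy field with $\binom3s$ components. Under a coordinate change $x=\psi(x')$ the components satisfy $u=w^{(s)}_\psi u'$ with $w^{(0)}_\psi=1$, $w^{(1)}_\psi=(D\psi^{-1})^t$, $w^{(2)}_\psi=\det(D\psi)^{-1}D\psi$, $w^{(3)}_\psi=\det(D\psi)^{-1}$; a tensor $A=(A^{ij})$ acts on pairs of $s$-forms by $A(v,w)=\sum_{i,j}A^{ij}v_iw_j$ and its components transform as $A'=(w^{(s)}_\psi)^tAw^{(s)}_\psi$. For fields on $K$, hats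 denote components in the reference coordinates $\hat x=\phi_K^{-1}(x)$, and tildes those in the coordinates $\tilde x=\phi^{-1}(\hat x)$. Let $Q_k^{l,m,n}=\operatorname{span}\{\frac{x^ay^bz^c}{(1+z)^k}: 0\le a\le l,\,0\le b\le m,\,0\le c\le n\}$ and $Q_k^{[l,m]}=\operatorname{span}\{\frac{x^ay^b}{(1+z)^c}: a,b,c\ge 0,\ c\le k,\ a\le c+l-k,\ b\le c+m-k\}$, and put $N_k=Q_{k+1}^{[k-1,k]}\times Q_{k+1}^{[k,k-1]}\times\{0\}$, $$\mathcal P^{(0)}_k=Q_k^{[k,k]},\quad \mathcal P^{(1)}_k=N_k+\nabla Q_k^{[k,k]},\quad \mathcal P^{(2)}_k=\bigl(\{0\}\times\{0\}\times Q_{k+2}^{[k-1,k-1]}\bigr)+\nabla\times N_k,\quad \mathcal P^{(3)}_k=Q_{k+3}^{[k-1,k-1]}.$$ Let $\mathcal P^{(s)}_k(K)$ be the space of smooth $s$-forms $u$ on $K$ with $\tilde u\in\mathcal P^{(s)}_k$, and let $\mathcal X^{(s)}_{r,k}(K)$ be the space of those $v\in\mathcal P^{(s)}_k(K)$ whose reference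 components satisfy $v_{\hat\imath}\circ\phi\in Q_r^{r+1,r+1,0}$ for all $\hat\imath$. Let $\xi_i,\lambda_i$ be the nodes and weights of the $(k+1)$-point Gauss–Legendre rule on $[0,1]$, and $\zeta_l,\mu_l$ those of the $(k+1)$-point Gauss–Jacobi rule on $[0,1]$ for the weight $(1-t)^2$. Set $S_{k,\hat K}(f)=\sum_{i,j,l}f(\xi_i(1-\zeta_l),\xi_j(1-\zeta_l),\zeta_l)\lambda_i\lambda_j\mu_l$, $S_{k,K}(f)=S_{k,\hat K}(|D\phi_K|\,f\circ\phi_K)$ and $E_{k,K}(f)=S_{k,K}(f)-\int_Kf\,dx$. Finally, let $|u|_{m,\hat K}=\sum_{\hat\imath}|u_{\hat\imath}|_{H^m(\hat K)}$, $\|u\|_{0,\hat K}=|u|_{0,\hat K}$ and $|A|_{m,\infty,\hat K}=\sum_{\hat\imath,\hat\jmath}|A^{\hat\imath\hat\jmath}|_{W^{m,\infty}(\hat K)}$. **Lemma.** For every integer $k\ge 0$ there is a constant $C=C(k)$, depending only on $k$, such that for all $s\in\{0,1,2,3\}$, all $r\in\{0,\dots,k\}$, all affine pyramids $K$, all $v\in\mathcal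 X^{(s)}_{r,k}(K)$, all $w\in\mathcal P^{(s)}_k(K)$ and all tensors $A$ on $K$ with components in $W^{k+1,\infty}(K)$ (taken with their continuous representatives), $$|E_{k,K}(A(v,w))|\le C\,|D\phi_K|\,|A|_{k-r+1,\infty,\hat K}\,|v|_{r,\hat K}\,\|w\|_{0,\hat K}.$$ -/

import Mathlib

open scoped ContDiff Matrix Polynomial

noncomputable section

namespace PyramidFE

/-! ### Domains and coordinate systems -/

/-- Three-dimensional coordinate space. Its `volume` is Lebesgue measure. -/
abbrev R3 : Type := Fin 3 → ℝ

/-- The (open) reference pyramid with base `[0,1]²` in the plane `ζ = 0` and apex `(0,0,1)`.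
All fields live on the open pyramid: the rational shape functions may be singular at the apex,
the quadrature nodes are interior points, and the boundary is a null set. -/
def refPyramid : Set R3 :=
  {p | 0 < p 2 ∧ 0 < p 0 ∧ p 0 < 1 - p 2 ∧ 0 < p 1 ∧ p 1 < 1 - p 2}

/-- The (open) infinite pyramid. -/
def infPyramid : Set R3 :=
  {p | 0 < p 0 ∧ p 0 < 1 ∧ 0 < p 1 ∧ p 1 < 1 ∧ 0 < p 2}

/-- The projective map from the infinite pyramid to the reference pyramid. -/
def projMap (p : R3) : R3 := ![p 0 / (1 + p 2), p 1 / (1 + p 2), p 2 / (1 + p 2)]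

/-- The affine (parallelogram-based) pyramid `K = φK(K̂)`, for an affine bijection `φK`. -/
def affinePyramid (φK : R3 ≃ᵃ[ℝ] R3) : Set R3 := φK '' refPyramid

/-- The Jacobian matrix of a map at a point. -/
def jacobian (φ : R3 → R3) (x : R3) : Matrix (Fin 3) (Fin 3) ℝ :=
  Matrix.of fun i j => fderiv ℝ φ x (Pi.single j 1) i

/-! ### Proxy fields of differential forms and their transformation -/

/-- The number `binom(3, s)` of components of (the proxy field of) an `s`-form. -/
abbrev proxyDim : Fin 4 → ℕ
  | 0 => 1
  | 1 => 3
  | 2 => 3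
  | 3 => 1

/-- A proxy field of an `s`-form, by its components in some coordinate system. -/
abbrev Proxy (s : Fin 4) : Type := R3 → Fin (proxyDim s) → ℝ

/-- The weight matrix of a coordinate change with Jacobian matrix `J = Dφ`, `x = φ(x')`: the
components of an `s`-form satisfy `u_i = ∑_{i'} weight_{i,i'} u_{i'}`. -/
def weight : (s : Fin 4) → Matrix (Fin 3) (Fin 3) ℝ →
    Matrix (Fin (proxyDim s)) (Fin (proxyDim s)) ℝ
  | 0, _ => Matrix.of fun _ _ => 1
  | 1, J => (J⁻¹)ᵀ
  | 2, J => J.det⁻¹ • J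
  | 3, J => Matrix.of fun _ _ => J.det⁻¹

/-- The components of the form `u` in the coordinate system `x'`, where `x = φ(x')`,
as functions of `x'`. -/
def changeCoords (s : Fin 4) (φ : R3 → R3) (u : Proxy s) : Proxy s :=
  fun x' => (weight s (jacobian φ x'))⁻¹ *ᵥ u (φ x')

/-- Gradient of a scalar field. -/
def grad (f : R3 → ℝ) (x : R3) : Fin 3 → ℝ := fun i => fderiv ℝ f x (Pi.single i 1)

/-- Curl of a vector field. -/
def curl (u : R3 → Fin 3 → ℝ) (x : R3) : Fin 3 → ℝ :=
  ![grad (fun y => u y 2) x 1 - grad (fun y => u y 1) x 2,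
    grad (fun y => u y 0) x 2 - grad (fun y => u y 2) x 0,
    grad (fun y => u y 1) x 0 - grad (fun y => u y 0) x 1]

/-! ### Weighted polynomials on the infinite pyramid and the approximation spaces -/

/-- `Q_k^{l,m,n}`: the `k`-weighted tensor product polynomials. -/
def weightedQ (k l m n : ℕ) : Submodule ℝ (R3 → ℝ) :=
  Submodule.span ℝ {f | ∃ a b c : ℕ, a ≤ l ∧ b ≤ m ∧ c ≤ n ∧
    f = fun p => p 0 ^ a * p 1 ^ b * p 2 ^ c / (1 + p 2) ^ k}

/-- `Q_k^{[l,m]}`: the span of `x^a y^b / (1+z)^c` with `c ≤ k`, `a ≤ c + l - k`,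
`b ≤ c + m - k`. -/
def bracketQ (k : ℕ) (l m : ℤ) : Submodule ℝ (R3 → ℝ) :=
  Submodule.span ℝ {f | ∃ a b c : ℕ, c ≤ k ∧ (a : ℤ) ≤ c + l - k ∧ (b : ℤ) ≤ c + m - k ∧
    f = fun p => p 0 ^ a * p 1 ^ b / (1 + p 2) ^ c}

/-- The spaces `𝒫^{(s)}_k` on the infinite pyramid (as fields determined on `infPyramid`). -/
def spaceP : (s : Fin 4) → (k : ℕ) → Set (Proxy s)
  | 0, k => {u | ∃ q ∈ bracketQ k k k, ∀ p ∈ infPyramid, u p = ![q p]}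
  | 1, k => {u | ∃ q₁ ∈ bracketQ (k + 1) (k - 1) k, ∃ q₂ ∈ bracketQ (k + 1) k (k - 1),
      ∃ q ∈ bracketQ k k k, ∀ p ∈ infPyramid, u p = ![q₁ p, q₂ p, 0] + grad q p}
  | 2, k => {u | ∃ q₃ ∈ bracketQ (k + 2) (k - 1) (k - 1),
      ∃ q₁ ∈ bracketQ (k + 1) (k - 1) k, ∃ q₂ ∈ bracketQ (k + 1) k (k - 1),
      ∀ p ∈ infPyramid, u p = ![0, 0, q₃ p] + curl (fun y => ![q₁ y, q₂ y, 0]) p}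
  | 3, k => {u | ∃ q ∈ bracketQ (k + 3) (k - 1) (k - 1), ∀ p ∈ infPyramid, u p = ![q p]}

/-- The approximation space `𝒫^{(s)}_k(K)`: smooth `s`-forms on `K` whose components in the
infinite pyramid coordinate system lie in `𝒫^{(s)}_k`. -/
def approxP (s : Fin 4) (k : ℕ) (φK : R3 ≃ᵃ[ℝ] R3) : Set (Proxy s) :=
  {u | ContDiffOn ℝ ∞ u (affinePyramid φK) ∧
    changeCoords s projMap (changeCoords s φK u) ∈ spaceP s k}

/-- `𝒳^{(s)}_{r,k}(K)`: the forms in `𝒫^{(s)}_k(K)` whose reference components are exactly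
`r`-weighted when composed with the projective map. -/
def approxX (s : Fin 4) (r k : ℕ) (φK : R3 ≃ᵃ[ℝ] R3) : Set (Proxy s) :=
  {v | v ∈ approxP s k φK ∧ ∀ i, ∃ q ∈ weightedQ r (r + 1) (r + 1) 0,
    ∀ p ∈ infPyramid, changeCoords s φK v (projMap p) i = q p}

/-! ### Tensors -/

/-- A tensor acting on pairs of `s`-forms, by its components `A^{ij}` in some coordinate system. -/
abbrev Tensor (s : Fin 4) : Type := R3 → Matrix (Fin (proxyDim s)) (Fin (proxyDim s)) ℝ

/-- The function `A(v,w) = ∑_{i,j} A^{ij} v_i w_j`. -/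
def tensorApply {s : Fin 4} (A : Tensor s) (v w : Proxy s) (x : R3) : ℝ :=
  ∑ i, ∑ j, A x i j * v x i * w x j

/-- The components of a tensor in the coordinate system `x'`, where `x = φ(x')`, as functions
of `x'`; this is the rule under which `A(v,w)` is a scalar. -/
def tensorChangeCoords (s : Fin 4) (φ : R3 → R3) (A : Tensor s) : Tensor s :=
  fun x' => (weight s (jacobian φ x'))ᵀ * A (φ x') * weight s (jacobian φ x')

/-! ### Sobolev spaces and (semi-)norms -/

/-- The `i`-th partial derivative. -/
def pderiv (i : Fin 3) (f : R3 → ℝ) : R3 → ℝ := fun x => fderiv ℝ f x (Pi.single i 1)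

/-- The classical partial derivative `∂^α f` for a multi-index `α`. -/
def multiDeriv (α : Fin 3 → ℕ) (f : R3 → ℝ) : R3 → ℝ :=
  (pderiv 0)^[α 0] ((pderiv 1)^[α 1] ((pderiv 2)^[α 2] f))

/-- The finite set of multi-indices of order `m`. -/
def multiIdx (m : ℕ) : Finset (Fin 3 → ℕ) := Finset.piAntidiag Finset.univ m

/-- `g` is the weak derivative `∂^α f` on the open set `U`. -/
def HasWeakDeriv (α : Fin 3 → ℕ) (f g : R3 → ℝ) (U : Set R3) : Prop :=
  MeasureTheory.LocallyIntegrableOn f U ∧ MeasureTheory.LocallyIntegrableOn g U ∧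
    ∀ ψ : R3 → ℝ, ContDiff ℝ ∞ ψ → HasCompactSupport ψ → tsupport ψ ⊆ U →
      ∫ x in U, f x * multiDeriv α ψ x = (-1) ^ (∑ i, α i) * ∫ x in U, g x * ψ x

/-- Membership in the Sobolev space `W^{m,∞}(U)`. -/
def MemWInf (m : ℕ) (f : R3 → ℝ) (U : Set R3) : Prop :=
  ∀ α : Fin 3 → ℕ, ∑ i, α i ≤ m →
    ∃ g, HasWeakDeriv α f g U ∧ MeasureTheory.MemLp g ⊤ (MeasureTheory.volume.restrict U)

open Classical in
/-- The weak derivative `∂^α f` on `U`, unique almost everywhere (and `0` if there is none). -/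
def weakDeriv (α : Fin 3 → ℕ) (f : R3 → ℝ) (U : Set R3) : R3 → ℝ :=
  if h : ∃ g, HasWeakDeriv α f g U then h.choose else 0

/-- The seminorm `|f|_{W^{m,∞}(U)} = max_{|α| = m} ‖∂^α f‖_{L^∞(U)}`. -/
def wInfSeminorm (m : ℕ) (f : R3 → ℝ) (U : Set R3) : ℝ :=
  ((multiIdx m).sup fun α =>
    MeasureTheory.eLpNorm (weakDeriv α f U) ⊤ (MeasureTheory.volume.restrict U)).toReal

/-- The seminorm `|f|_{H^m(U)}` of a function that is smooth on the open set `U`: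
the square root of `∑_{|α| = m} ‖∂^α f‖²_{L²(U)}`. -/
def hSeminorm (m : ℕ) (f : R3 → ℝ) (U : Set R3) : ℝ :=
  Real.sqrt (∑ α ∈ multiIdx m,
    MeasureTheory.eLpNorm (multiDeriv α f) 2 (MeasureTheory.volume.restrict U) ^ 2).toReal

/-- `A ∈ W^{m,∞}Θ^{(s)}(U)`; `A` is the continuous representative, so that it has point values. -/
def MemWInfTensor {s : Fin 4} (m : ℕ) (A : Tensor s) (U : Set R3) : Prop :=
  ∀ i j, MemWInf m (fun x => A x i j) U ∧ ContinuousOn (fun x => A x i j) U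

/-- The reference seminorm `|u|_{m,K̂}` of an `s`-form on `K = φK(K̂)`; for `m = 0` this is the
norm `‖u‖_{0,K̂}`. -/
def refSeminorm {s : Fin 4} (m : ℕ) (φK : R3 ≃ᵃ[ℝ] R3) (u : Proxy s) : ℝ :=
  ∑ i, hSeminorm m (fun x => changeCoords s φK u x i) refPyramid

/-- The reference seminorm `|A|_{m,∞,K̂}` of a tensor on `K = φK(K̂)`. -/
def refTensorSeminorm {s : Fin 4} (m : ℕ) (φK : R3 ≃ᵃ[ℝ] R3) (A : Tensor s) : ℝ :=
  ∑ i, ∑ j, wInfSeminorm m (fun x => tensorChangeCoords s φK A x i j) refPyramid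

/-! ### Quadrature -/

/-- The Jacobi polynomial `P_n^{(a,b)}(2t - 1)`, orthogonal on `[0,1]` for `(1-t)^a t^b`. -/
def jacobiPoly (n a b : ℕ) : ℝ[X] :=
  ∑ j ∈ Finset.range (n + 1),
    Polynomial.C (((n + a).choose (n - j) * (n + b).choose j : ℕ) : ℝ) *
      (Polynomial.X - 1) ^ j * Polynomial.X ^ (n - j)

/-- The nodes of the `n`-point Gauss–Jacobi rule on `[0,1]`. -/
def gaussNodes (n a b : ℕ) : Finset ℝ := (jacobiPoly n a b).roots.toFinset

/-- The weights of the `n`-point Gauss–Jacobi rule on `[0,1]`: the weighted integrals of the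
Lagrange basis polynomials of the nodes. -/
def gaussWeight (n a b : ℕ) (x : ℝ) : ℝ :=
  ∫ t in (0 : ℝ)..1, (1 - t) ^ a * t ^ b * (Lagrange.basis (gaussNodes n a b) id x).eval t

/-- The conical product rule `S_{k,K̂}`, from the `k+1` point Gauss–Legendre rule and the
`k+1` point Gauss–Jacobi rule for the weight `(1-t)²`. -/
def quadRef (k : ℕ) (f : R3 → ℝ) : ℝ :=
  ∑ x ∈ gaussNodes (k + 1) 0 0, ∑ y ∈ gaussNodes (k + 1) 0 0, ∑ z ∈ gaussNodes (k + 1) 2 0,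
    f ![x * (1 - z), y * (1 - z), z] *
      (gaussWeight (k + 1) 0 0 x * gaussWeight (k + 1) 0 0 y * gaussWeight (k + 1) 2 0 z)

/-- The quadrature error `E_{k,K̂}` on the reference pyramid. -/
def errRef (k : ℕ) (f : R3 → ℝ) : ℝ := quadRef k f - ∫ x in refPyramid, f x

/-- The factor `|Dφ_K|`: the absolute value of the (constant) Jacobian determinant of `φK`. -/
def jacDet (φK : R3 ≃ᵃ[ℝ] R3) : ℝ := |LinearMap.det (φK.linear : R3 →ₗ[ℝ] R3)|

/-- The quadrature scheme `S_{k,K}` on `K = φK(K̂)`. -/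
def quad (k : ℕ) (φK : R3 ≃ᵃ[ℝ] R3) (f : R3 → ℝ) : ℝ :=
  quadRef k fun x => jacDet φK * f (φK x)

/-- The quadrature error `E_{k,K}(f) = S_{k,K}(f) - ∫_K f` on `K = φK(K̂)`. -/
def err (k : ℕ) (φK : R3 ≃ᵃ[ℝ] R3) (f : R3 → ℝ) : ℝ :=
  quad k φK f - ∫ x in affinePyramid φK, f x

end PyramidFE

end

/-!
Everything is pulled back to the reference pyramid. There the quadrature rule is exact on
`p * v * w` for polynomials `p` of degree at most `k - r`: after the Duffy transform
`(x, y, z) ↦ (x (1 - z), y (1 - z), z)` such products are polynomials of degree at most `2 k + 1` in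
each variable, because a component of `v` has weight exactly `r` and a component of `w` weight at
most `k` in `1 - z`. Subtracting a Taylor polynomial of a (mollified) component of the tensor
therefore costs `|A|_{k-r+1,∞}` times the sup norms of the components of `v` and `w`. These
components range over finite-dimensional spaces, so their sup norms are controlled by any norm. On
the components of `v` the seminorm `|·|_r` is one: these functions are homogeneous of degree `r`
about the apex, and such a function vanishes if its derivatives of order `r` do.
-/

namespace PyramidFE

open MeasureTheory Filter Set
open scoped Topology Convolution

/-! ### Classical partial derivatives -/

section MultiDeriv

variable {U : Set R3} {f g : R3 → ℝ} {n : ℕ}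

lemma pderiv_contDiffOn (hU : IsOpen U) (hf : ContDiffOn ℝ ∞ f U) (i : Fin 3) :
    ContDiffOn ℝ ∞ (pderiv i f) U :=
  (hf.fderiv_of_isOpen hU (by simp)).clm_apply contDiffOn_const

lemma pderiv_congr (hU : IsOpen U) (h : EqOn f g U) (i : Fin 3) :
    EqOn (pderiv i f) (pderiv i g) U := fun x hx => by
  have hfg : f =ᶠ[𝓝 x] g := eventuallyEq_of_mem (hU.mem_nhds hx) h
  simp only [pderiv, hfg.fderiv_eq]

lemma pderiv_comm (hU : IsOpen U) (hf : ContDiffOn ℝ ∞ f U) (i j : Fin 3) :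
    EqOn (pderiv i (pderiv j f)) (pderiv j (pderiv i f)) U := by
  intro x hx
  have hfx : ContDiffAt ℝ ∞ f x := hf.contDiffAt (hU.mem_nhds hx)
  have hf' : DifferentiableAt ℝ (fderiv ℝ f) x :=
    (hfx.fderiv_right (m := ∞) (by simp)).differentiableAt (by simp)
  have second (i j : Fin 3) : pderiv i (pderiv j f) x =
      fderiv ℝ (fderiv ℝ f) x (Pi.single i 1) (Pi.single j 1) := by
    unfold pderiv
    rw [fderiv_clm_apply hf' (differentiableAt_const _)]
    simp
  rw [second, second]
  have hsymm : IsSymmSndFDerivAt ℝ f x := hfx.isSymmSndFDerivAt (by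
    simp only [minSmoothness_of_isRCLikeNormedField]; exact ENat.LEInfty.out)
  exact hsymm.eq _ _

lemma multiDeriv_induction {R : (R3 → ℝ) → (R3 → ℝ) → Prop}
    (step : ∀ i f g, R f g → R (pderiv i f) (pderiv i g)) (α : Fin 3 → ℕ) (h : R f g) :
    R (multiDeriv α f) (multiDeriv α g) := by
  have iterate (i : Fin 3) (n : ℕ) {f g : R3 → ℝ} (h : R f g) :
      R ((pderiv i)^[n] f) ((pderiv i)^[n] g) := by
    induction n with
    | zero => exact h
    | succ n ih =>
      simp only [Function.iterate_succ_apply']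
      exact step i _ _ ih
  exact iterate 0 _ (iterate 1 _ (iterate 2 _ h))

lemma multiDeriv_contDiffOn (hU : IsOpen U) (hf : ContDiffOn ℝ ∞ f U) (α : Fin 3 → ℕ) :
    ContDiffOn ℝ ∞ (multiDeriv α f) U :=
  multiDeriv_induction (R := fun f _ => ContDiffOn ℝ ∞ f U) (g := 0)
    (fun i _ _ h => pderiv_contDiffOn hU h i) α hf

lemma multiDeriv_contDiff (hf : ContDiff ℝ ∞ f) (α : Fin 3 → ℕ) :
    ContDiff ℝ ∞ (multiDeriv α f) :=
  contDiffOn_univ.1 (multiDeriv_contDiffOn isOpen_univ hf.contDiffOn α)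

lemma multiDeriv_congr (hU : IsOpen U) (h : EqOn f g U) (α : Fin 3 → ℕ) :
    EqOn (multiDeriv α f) (multiDeriv α g) U :=
  multiDeriv_induction (R := fun f g => EqOn f g U) (fun i _ _ h => pderiv_congr hU h i) α h

lemma tsupport_multiDeriv_subset (f : R3 → ℝ) (α : Fin 3 → ℕ) :
    tsupport (multiDeriv α f) ⊆ tsupport f :=
  multiDeriv_induction (R := fun h _ => tsupport h ⊆ tsupport f) (g := 0)
    (fun i _ _ h => (tsupport_fderiv_apply_subset ℝ (Pi.single i 1)).trans h) α subset_rfl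

lemma hasCompactSupport_multiDeriv (h : HasCompactSupport f) (α : Fin 3 → ℕ) :
    HasCompactSupport (multiDeriv α f) :=
  h.of_isClosed_subset (isClosed_tsupport _) (tsupport_multiDeriv_subset f α)

lemma multiDeriv_pderiv_comm (hU : IsOpen U) (hf : ContDiffOn ℝ ∞ f U) (α : Fin 3 → ℕ)
    (j : Fin 3) : EqOn (pderiv j (multiDeriv α f)) (multiDeriv α (pderiv j f)) U :=
  (multiDeriv_induction (R := fun f g => ContDiffOn ℝ ∞ f U ∧ EqOn (pderiv j f) g U)
    (fun i _ _ h => ⟨pderiv_contDiffOn hU h.1 i,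
      (pderiv_comm hU h.1 j i).trans (pderiv_congr hU h.2 i)⟩) α ⟨hf, eqOn_refl _ _⟩).2

lemma pderiv_multiDeriv (hU : IsOpen U) (hf : ContDiffOn ℝ ∞ f U) (α : Fin 3 → ℕ) (i : Fin 3) :
    EqOn (pderiv i (multiDeriv α f)) (multiDeriv (α + Pi.single i 1) f) U := by
  intro x hx
  have h₂ := multiDeriv_contDiffOn hU hf ![0, 0, α 2]
  have h₁ := multiDeriv_contDiffOn hU hf ![0, α 1, α 2]
  match i with
  | 0 => simp [multiDeriv, Function.iterate_succ_apply']
  | 1 =>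
    rw [show multiDeriv α f = multiDeriv ![α 0, 0, 0] (multiDeriv ![0, α 1, α 2] f) from rfl,
      multiDeriv_pderiv_comm hU h₁ _ _ hx]
    simp [multiDeriv, Function.iterate_succ_apply']
  | 2 =>
    rw [show multiDeriv α f = multiDeriv ![α 0, α 1, 0] (multiDeriv ![0, 0, α 2] f) from rfl,
      multiDeriv_pderiv_comm hU h₂ _ _ hx]
    simp [multiDeriv, Function.iterate_succ_apply']

/-- The multi-index counting how often each coordinate occurs among the entries of `w`. -/
def coordCount (w : Fin n → Fin 3) : Fin 3 → ℕ := ∑ j, Pi.single (w j) 1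

lemma sum_coordCount (w : Fin n → Fin 3) : ∑ i, coordCount w i = n := by
  simp only [coordCount, Finset.sum_apply]
  rw [Finset.sum_comm]
  simp

lemma exists_coordCount_eq {α : Fin 3 → ℕ} (hα : ∑ i, α i = n) :
    ∃ w : Fin n → Fin 3, coordCount w = α := by
  induction n generalizing α with
  | zero => exact ⟨Fin.elim0, by ext i; simp_all [coordCount]⟩
  | succ n ih =>
    obtain ⟨i, hi⟩ : ∃ i, α i ≠ 0 := by
      by_contra! h
      simp [h] at hα
    have hsplit : Pi.single i 1 + (α - Pi.single i 1) = α :=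
      add_tsub_cancel_of_le
        (update_le_iff.2 ⟨Nat.one_le_iff_ne_zero.2 hi, fun j _ => Nat.zero_le _⟩)
    obtain ⟨w, hw⟩ := ih (α := α - Pi.single i 1) (by
      rw [← hsplit] at hα
      simp only [Pi.add_apply, Finset.sum_add_distrib, Finset.sum_pi_single', Finset.mem_univ,
        if_true] at hα
      omega)
    refine ⟨Fin.cons i w, ?_⟩
    rw [coordCount, Fin.sum_univ_succ, Fin.cons_zero]
    simp only [Fin.cons_succ]
    rw [← coordCount, hw, hsplit]

lemma iteratedFDeriv_single_eq_multiDeriv (hU : IsOpen U) (hf : ContDiffOn ℝ ∞ f U)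
    (w : Fin n → Fin 3) : EqOn (fun x => iteratedFDeriv ℝ n f x fun j => Pi.single (w j) 1)
      (multiDeriv (coordCount w) f) U := by
  induction n with
  | zero => exact fun x _ => by simp [coordCount, multiDeriv]
  | succ n ih =>
    intro x hx
    have hdiff : DifferentiableAt ℝ (iteratedFDeriv ℝ n f) x :=
      (hf.contDiffAt (hU.mem_nhds hx)).differentiableAt_iteratedFDeriv (by
        exact_mod_cast ENat.natCast_lt_top n)
    calc iteratedFDeriv ℝ (n + 1) f x (fun j => Pi.single (w j) 1)
        = pderiv (w 0) (fun y => iteratedFDeriv ℝ n f y fun j => Pi.single (w j.succ) 1) x :=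
          hdiff.iteratedFDeriv_succ_apply_left'
      _ = pderiv (w 0) (multiDeriv (coordCount (Fin.tail w)) f) x :=
          pderiv_congr hU (ih (Fin.tail w)) _ hx
      _ = multiDeriv (coordCount w) f x := by
          rw [pderiv_multiDeriv hU hf _ _ hx, coordCount, coordCount, Fin.sum_univ_succ, add_comm]
          rfl

lemma iteratedFDeriv_apply_eq_sum_multiDeriv (hU : IsOpen U) (hf : ContDiffOn ℝ ∞ f U)
    (v : Fin n → R3) {x : R3} (hx : x ∈ U) :
    iteratedFDeriv ℝ n f x v =
      ∑ w : Fin n → Fin 3, (∏ j, v j (w j)) * multiDeriv (coordCount w) f x := by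
  have hv : v = fun j => ∑ i, v j i • Pi.single i (1 : ℝ) := funext fun j =>
    pi_eq_sum_univ' (v j)
  conv_lhs => rw [hv]
  rw [ContinuousMultilinearMap.map_sum]
  refine Finset.sum_congr rfl fun w _ => ?_
  rw [ContinuousMultilinearMap.map_smul_univ, smul_eq_mul,
    ← iteratedFDeriv_single_eq_multiDeriv hU hf w hx]

lemma exists_multiDeriv_eq_iteratedFDeriv (hU : IsOpen U) {α : Fin 3 → ℕ} (hα : ∑ i, α i = n) :
    ∃ v : Fin n → R3, ∀ f, ContDiffOn ℝ ∞ f U → ∀ x ∈ U,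
      multiDeriv α f x = iteratedFDeriv ℝ n f x v := by
  obtain ⟨w, rfl⟩ := exists_coordCount_eq hα
  exact ⟨_, fun f hf x hx => (iteratedFDeriv_single_eq_multiDeriv hU hf w hx).symm⟩

lemma multiDeriv_add (hU : IsOpen U) (hf : ContDiffOn ℝ ∞ f U) (hg : ContDiffOn ℝ ∞ g U)
    (α : Fin 3 → ℕ) : EqOn (multiDeriv α (f + g)) (multiDeriv α f + multiDeriv α g) U := by
  obtain ⟨v, hv⟩ := exists_multiDeriv_eq_iteratedFDeriv hU (α := α) rfl
  intro x hx
  have smooth {h : R3 → ℝ} (hh : ContDiffOn ℝ ∞ h U) : ContDiffAt ℝ (∑ i, α i : ℕ) h x :=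
    (hh.contDiffAt (hU.mem_nhds hx)).of_le (by exact_mod_cast le_top)
  rw [Pi.add_apply, hv (f + g) (hf.add hg) x hx, hv f hf x hx, hv g hg x hx,
    iteratedFDeriv_add_apply (smooth hf) (smooth hg)]
  rfl

lemma multiDeriv_smul (hU : IsOpen U) (hf : ContDiffOn ℝ ∞ f U) (c : ℝ) (α : Fin 3 → ℕ) :
    EqOn (multiDeriv α (c • f)) (c • multiDeriv α f) U := by
  obtain ⟨v, hv⟩ := exists_multiDeriv_eq_iteratedFDeriv hU (α := α) rfl
  intro x hx
  rw [Pi.smul_apply, hv (c • f) (contDiffOn_const.smul hf) x hx, hv f hf x hx,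
    iteratedFDeriv_const_smul_apply
      ((hf.contDiffAt (hU.mem_nhds hx)).of_le (by exact_mod_cast le_top))]
  rfl

lemma multiDeriv_comp_homothety (hf : ContDiff ℝ ∞ f) (b : R3) (c : ℝ) (α : Fin 3 → ℕ) (y : R3) :
    multiDeriv α (fun y => f (b + c • y)) y = c ^ (∑ i, α i) * multiDeriv α f (b + c • y) := by
  obtain ⟨v, hv⟩ := exists_multiDeriv_eq_iteratedFDeriv isOpen_univ (α := α) rfl
  have hfb : ContDiff ℝ ∞ fun y => f (b + y) := by fun_prop
  have hfbc : ContDiff ℝ ∞ fun y => f (b + c • y) := by fun_prop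
  rw [hv _ hfbc.contDiffOn y trivial, hv f hf.contDiffOn _ trivial,
    iteratedFDeriv_comp_const_smul (f := fun y => f (b + y)) c
      (hfb.of_le (by exact_mod_cast le_top))]
  simp only [iteratedFDeriv_comp_add_left, smul_apply, smul_eq_mul]

lemma mem_multiIdx {α : Fin 3 → ℕ} : α ∈ multiIdx n ↔ ∑ i, α i = n := by
  simp [multiIdx]

end MultiDeriv

/-! ### Affine changes of variables -/

section AffineEquiv

variable {E : Type*} [NormedAddCommGroup E] [NormedSpace ℝ E]

lemma affineEquiv_apply (φ : E ≃ᵃ[ℝ] E) (x : E) : φ x = φ.linear x + φ 0 :=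
  congrFun (AffineMap.decomp (φ : E →ᵃ[ℝ] E)) x

lemma det_linear_ne_zero (φ : E ≃ᵃ[ℝ] E) : LinearMap.det (φ.linear : E →ₗ[ℝ] E) ≠ 0 :=
  (LinearEquiv.isUnit_det' φ.linear).ne_zero

variable [FiniteDimensional ℝ E]

lemma hasFDerivAt_affineEquiv (φ : E ≃ᵃ[ℝ] E) (x : E) :
    HasFDerivAt φ (LinearMap.toContinuousLinearMap (φ.linear : E →ₗ[ℝ] E)) x :=
  (AffineEquiv.toContinuousAffineEquiv φ).toContinuousAffineMap.hasFDerivAt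

lemma contDiff_affineEquiv (φ : E ≃ᵃ[ℝ] E) {n : WithTop ℕ∞} : ContDiff ℝ n φ :=
  (AffineEquiv.toContinuousAffineEquiv φ).toContinuousAffineMap.contDiff

lemma isOpen_image_affineEquiv (φ : E ≃ᵃ[ℝ] E) {V : Set E} (hV : IsOpen V) : IsOpen (φ '' V) :=
  (AffineEquiv.toContinuousAffineEquiv φ).toHomeomorph.isOpenMap V hV

variable [MeasurableSpace E] [BorelSpace E] (μ : Measure E) [μ.IsAddHaarMeasure]

lemma quasiMeasurePreserving_affineEquiv (φ : E ≃ᵃ[ℝ] E) :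
    Measure.QuasiMeasurePreserving φ μ μ := by
  have hlin : Measure.QuasiMeasurePreserving (φ.linear : E →ₗ[ℝ] E) μ μ :=
    ⟨(LinearMap.continuous_of_finiteDimensional _).measurable, by
      rw [Measure.map_linearMap_addHaar_eq_smul_addHaar μ (det_linear_ne_zero φ)]
      exact Measure.smul_absolutelyContinuous⟩
  rw [funext (affineEquiv_apply φ)]
  exact (quasiMeasurePreserving_add_right μ (φ 0)).comp hlin

end AffineEquiv

lemma jacDet_pos (φ : R3 ≃ᵃ[ℝ] R3) : 0 < jacDet φ := abs_pos.2 (det_linear_ne_zero φ)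

lemma setIntegral_image_affineEquiv (φ : R3 ≃ᵃ[ℝ] R3) {V : Set R3} (hV : MeasurableSet V)
    (f : R3 → ℝ) : ∫ y in φ '' V, f y = jacDet φ * ∫ x in V, f (φ x) := by
  rw [integral_image_eq_integral_abs_det_fderiv_smul volume hV
    (fun x _ => (hasFDerivAt_affineEquiv φ x).hasFDerivWithinAt) φ.injective.injOn,
    ← integral_const_mul]
  rfl

lemma exists_multiDeriv_comp_affineEquiv (φ : R3 ≃ᵃ[ℝ] R3) {n : ℕ} {α : Fin 3 → ℕ}
    (hα : ∑ i, α i = n) :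
    ∃ c : (Fin n → Fin 3) → ℝ, ∀ f : R3 → ℝ, ContDiff ℝ ∞ f → ∀ x,
      multiDeriv α (f ∘ φ) x = ∑ w, c w * multiDeriv (coordCount w) f (φ x) := by
  obtain ⟨v, hv⟩ := exists_multiDeriv_eq_iteratedFDeriv isOpen_univ hα
  set L : R3 →L[ℝ] R3 := LinearMap.toContinuousLinearMap φ.linear
  refine ⟨fun w => ∏ j, L (v j) (w j), fun f hf x => ?_⟩
  have hshift : ContDiff ℝ ∞ fun y => f (y + φ 0) := by fun_prop
  calc multiDeriv α (f ∘ φ) x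
      = iteratedFDeriv ℝ n ((fun y => f (y + φ 0)) ∘ L) x v := by
        rw [hv _ (hf.comp (contDiff_affineEquiv φ)).contDiffOn x trivial,
          show f ∘ φ = (fun y => f (y + φ 0)) ∘ L from
            funext fun y => congrArg f (affineEquiv_apply φ y)]
    _ = iteratedFDeriv ℝ n f (φ x) fun j => L (v j) := by
        rw [L.iteratedFDeriv_comp_right hshift x (by exact_mod_cast le_top),
          iteratedFDeriv_comp_add_right, affineEquiv_apply φ x]
        rfl
    _ = _ := iteratedFDeriv_apply_eq_sum_multiDeriv isOpen_univ hf.contDiffOn _ trivial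

/-! ### Weak derivatives -/

section WeakDeriv

variable {U V : Set R3} {α : Fin 3 → ℕ} {f g ψ : R3 → ℝ} {m : ℕ}

lemma integrable_mul_of_tsupport_subset (hg : LocallyIntegrableOn g U) (hψ : Continuous ψ)
    (hc : HasCompactSupport ψ) (hs : tsupport ψ ⊆ U) : Integrable fun x => g x * ψ x :=
  (integrableOn_iff_integrable_of_support_subset
    ((Function.support_mul_subset_right g ψ).trans (subset_tsupport ψ))).1
    ((hg.integrableOn_compact_subset hs hc).mul_continuousOn hψ.continuousOn hc)

lemma integrable_mul_multiDeriv (hg : LocallyIntegrableOn g U) (hψ : ContDiff ℝ ∞ ψ)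
    (hc : HasCompactSupport ψ) (hs : tsupport ψ ⊆ U) (α : Fin 3 → ℕ) :
    Integrable fun x => g x * multiDeriv α ψ x :=
  integrable_mul_of_tsupport_subset hg (multiDeriv_contDiff hψ α).continuous
    (hasCompactSupport_multiDeriv hc α) ((tsupport_multiDeriv_subset ψ α).trans hs)

lemma setIntegral_mul_of_tsupport_subset (g : R3 → ℝ) (hs : tsupport ψ ⊆ U) :
    ∫ x in U, g x * ψ x = ∫ x, g x * ψ x :=
  setIntegral_eq_integral_of_forall_compl_eq_zero fun x hx => by
    rw [image_eq_zero_of_notMem_tsupport fun h => hx (hs h), mul_zero]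

lemma locallyIntegrableOn_of_memLp_top (hf : MemLp f ⊤ (volume.restrict U)) :
    LocallyIntegrableOn f U :=
  locallyIntegrableOn_of_locallyIntegrable_restrict (hf.locallyIntegrable (by simp))

lemma hasWeakDeriv_zero (hf : LocallyIntegrableOn f U) : HasWeakDeriv 0 f f U :=
  ⟨hf, hf, fun ψ _ _ _ => by simp [multiDeriv]⟩

lemma HasWeakDeriv.ae_eq {g' : R3 → ℝ} (hU : IsOpen U) (h : HasWeakDeriv α f g U)
    (h' : HasWeakDeriv α f g' U) : g =ᵐ[volume.restrict U] g' := by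
  have hzero : ∀ᵐ x, x ∈ U → (g - g') x = 0 := by
    refine hU.ae_eq_zero_of_integral_contDiff_smul_eq_zero (h.2.1.sub h'.2.1) fun ψ hψ hc hs => ?_
    have heq : ∫ x, g x * ψ x = ∫ x, g' x * ψ x := by
      rw [← setIntegral_mul_of_tsupport_subset g hs, ← setIntegral_mul_of_tsupport_subset g' hs]
      exact mul_left_cancel₀ (pow_ne_zero _ (by norm_num))
        ((h.2.2 ψ hψ hc hs).symm.trans (h'.2.2 ψ hψ hc hs))
    calc ∫ x, ψ x • (g - g') x = ∫ x, (g x * ψ x - g' x * ψ x) := by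
          simp only [Pi.sub_apply, smul_eq_mul, mul_comm (ψ _), sub_mul]
      _ = 0 := by
          rw [integral_sub (integrable_mul_of_tsupport_subset h.2.1 hψ.continuous hc hs)
            (integrable_mul_of_tsupport_subset h'.2.1 hψ.continuous hc hs), heq, sub_self]
  rw [Filter.EventuallyEq, ae_restrict_iff' hU.measurableSet]
  filter_upwards [hzero] with x hx hxU
  exact sub_eq_zero.1 (hx hxU)

lemma HasWeakDeriv.add {f₁ f₂ g₁ g₂ : R3 → ℝ} (h₁ : HasWeakDeriv α f₁ g₁ U)
    (h₂ : HasWeakDeriv α f₂ g₂ U) : HasWeakDeriv α (f₁ + f₂) (g₁ + g₂) U := by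
  refine ⟨h₁.1.add h₂.1, h₁.2.1.add h₂.2.1, fun ψ hψ hc hs => ?_⟩
  have integrable_deriv {f : R3 → ℝ} (hf : LocallyIntegrableOn f U) :
      IntegrableOn (fun x => f x * multiDeriv α ψ x) U :=
    (integrable_mul_multiDeriv hf hψ hc hs α).integrableOn
  have integrable {f : R3 → ℝ} (hf : LocallyIntegrableOn f U) :
      IntegrableOn (fun x => f x * ψ x) U :=
    (integrable_mul_of_tsupport_subset hf hψ.continuous hc hs).integrableOn
  simp only [Pi.add_apply, add_mul]
  rw [integral_add (integrable_deriv h₁.1) (integrable_deriv h₂.1),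
    integral_add (integrable h₁.2.1) (integrable h₂.2.1),
    h₁.2.2 ψ hψ hc hs, h₂.2.2 ψ hψ hc hs, mul_add]

lemma HasWeakDeriv.const_smul (h : HasWeakDeriv α f g U) (c : ℝ) :
    HasWeakDeriv α (c • f) (c • g) U := by
  refine ⟨h.1.smul c, h.2.1.smul c, fun ψ hψ hc hs => ?_⟩
  simp only [Pi.smul_apply, smul_eq_mul, mul_assoc]
  rw [integral_const_mul, integral_const_mul, h.2.2 ψ hψ hc hs, mul_left_comm]

lemma MemWInf.add (hf : MemWInf m f U) (hg : MemWInf m g U) : MemWInf m (f + g) U :=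
  fun α hα => by
    obtain ⟨f', hf', hf'_top⟩ := hf α hα
    obtain ⟨g', hg', hg'_top⟩ := hg α hα
    exact ⟨f' + g', hf'.add hg', hf'_top.add hg'_top⟩

lemma MemWInf.const_smul (hf : MemWInf m f U) (c : ℝ) : MemWInf m (c • f) U := fun α hα => by
  obtain ⟨f', hf', hf'_top⟩ := hf α hα
  exact ⟨c • f', hf'.const_smul c, hf'_top.const_smul c⟩

lemma MemWInf.zero (m : ℕ) (U : Set R3) : MemWInf m 0 U := fun α _ =>
  ⟨0, ⟨locallyIntegrableOn_zero, locallyIntegrableOn_zero, fun ψ _ _ _ => by simp⟩, MemLp.zero⟩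

lemma MemWInf.sum {ι : Type*} {f : ι → R3 → ℝ} (s : Finset ι)
    (hf : ∀ i ∈ s, MemWInf m (f i) U) : MemWInf m (∑ i ∈ s, f i) U :=
  Finset.sum_induction f (MemWInf m · U) (fun _ _ => MemWInf.add) (MemWInf.zero m U) hf

lemma MemWInf.memLp (hU : IsOpen U) (hf : MemWInf m f U) : MemLp f ⊤ (volume.restrict U) := by
  obtain ⟨g, hg, hg_top⟩ := hf 0 (by simp)
  exact (memLp_congr_ae ((hasWeakDeriv_zero hg.1).ae_eq hU hg)).2 hg_top

lemma MemWInf.hasWeakDeriv_weakDeriv (hU : IsOpen U) (hf : MemWInf m f U) (hα : ∑ i, α i ≤ m) :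
    HasWeakDeriv α f (weakDeriv α f U) U ∧
      MemLp (weakDeriv α f U) ⊤ (volume.restrict U) := by
  obtain ⟨g, hg, hg_top⟩ := hf α hα
  have hex : ∃ g, HasWeakDeriv α f g U := ⟨g, hg⟩
  have hspec : HasWeakDeriv α f (weakDeriv α f U) U := by
    rw [weakDeriv, dif_pos hex]
    exact hex.choose_spec
  exact ⟨hspec, (memLp_congr_ae (hspec.ae_eq hU hg)).2 hg_top⟩

lemma MemWInf.ae_abs_weakDeriv_le {n : ℕ} (hU : IsOpen U) (hf : MemWInf m f U) (hn : n ≤ m)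
    (hα : ∑ i, α i = n) :
    ∀ᵐ x ∂volume.restrict U, |weakDeriv α f U x| ≤ wInfSeminorm n f U := by
  have hfinite : (multiIdx n).sup (fun β => eLpNorm (weakDeriv β f U) ⊤ (volume.restrict U)) < ⊤ :=
    (Finset.sup_lt_iff (by simp)).2 fun β hβ =>
      (hf.hasWeakDeriv_weakDeriv hU ((mem_multiIdx.1 hβ).trans_le hn)).2.2
  filter_upwards [ae_le_eLpNormEssSup (f := weakDeriv α f U) (μ := volume.restrict U)] with x hx
  rw [← eLpNorm_exponent_top] at hx
  rw [← Real.norm_eq_abs, ← toReal_enorm]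
  exact ENNReal.toReal_mono hfinite.ne (hx.trans
    (Finset.le_sup (f := fun β => eLpNorm (weakDeriv β f U) ⊤ (volume.restrict U))
      (mem_multiIdx.2 hα)))

lemma memLp_top_comp_quasiMeasurePreserving {X Y E : Type*} [MeasurableSpace X]
    [MeasurableSpace Y] [NormedAddCommGroup E] {μ : Measure X} {ν : Measure Y} {φ : X → Y}
    {f : Y → E} (hf : MemLp f ⊤ ν) (hφ : Measure.QuasiMeasurePreserving φ μ ν) :
    MemLp (f ∘ φ) ⊤ μ := by
  have hmono := eLpNormEssSup_mono_measure f hφ.absolutelyContinuous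
  rw [eLpNormEssSup_map_measure (hf.1.mono_ac hφ.absolutelyContinuous) hφ.aemeasurable] at hmono
  refine ⟨hf.1.comp_quasiMeasurePreserving hφ, ?_⟩
  rw [eLpNorm_exponent_top]
  exact hmono.trans_lt (by simpa using hf.2)

lemma memLp_top_comp_affineEquiv (φ : R3 ≃ᵃ[ℝ] R3) (hf : MemLp f ⊤ (volume.restrict (φ '' V))) :
    MemLp (f ∘ φ) ⊤ (volume.restrict V) :=
  memLp_top_comp_quasiMeasurePreserving hf
    ((quasiMeasurePreserving_affineEquiv volume φ).restrict (mapsTo_image _ _))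

lemma setIntegral_comp_affineEquiv_mul (φ : R3 ≃ᵃ[ℝ] R3) (hV : IsOpen V)
    {c : (Fin m → Fin 3) → ℝ} {g : (Fin m → Fin 3) → R3 → ℝ}
    (hg : ∀ w, HasWeakDeriv (coordCount w) f (g w) (φ '' V))
    (hψ : ContDiff ℝ ∞ ψ) (hψc : HasCompactSupport ψ) (hψs : tsupport ψ ⊆ φ '' V) :
    ∫ x in V, f (φ x) * ∑ w, c w * multiDeriv (coordCount w) ψ (φ x) =
      (-1) ^ m * ∫ x in V, (∑ w, c w * g w (φ x)) * ψ (φ x) := by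
  have himage := setIntegral_image_affineEquiv φ hV.measurableSet
  apply mul_left_cancel₀ (jacDet_pos φ).ne'
  rw [mul_left_comm, ← himage fun y => f y * ∑ w, c w * multiDeriv (coordCount w) ψ y,
    ← himage fun y => (∑ w, c w * g w y) * ψ y]
  simp only [Finset.mul_sum, Finset.sum_mul, mul_left_comm (f _), mul_assoc]
  rw [integral_finsetSum _ fun w _ =>
      ((integrable_mul_multiDeriv (hg w).1 hψ hψc hψs _).const_mul (c w)).integrableOn,
    integral_finsetSum _ fun w _ => ((integrable_mul_of_tsupport_subset (hg w).2.1
      hψ.continuous hψc hψs).const_mul (c w)).integrableOn, Finset.mul_sum]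
  refine Finset.sum_congr rfl fun w _ => ?_
  rw [integral_const_mul, integral_const_mul, (hg w).2.2 ψ hψ hψc hψs, sum_coordCount,
    mul_left_comm]

lemma MemWInf.comp_affineEquiv (φ : R3 ≃ᵃ[ℝ] R3) (hV : IsOpen V) (hf : MemWInf m f (φ '' V)) :
    MemWInf m (f ∘ φ) V := by
  intro α hα
  obtain ⟨c, hc⟩ := exists_multiDeriv_comp_affineEquiv φ (α := α) rfl
  choose g hg hg_top using fun w : Fin (∑ i, α i) → Fin 3 =>
    hf (coordCount w) ((sum_coordCount w).trans_le hα)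
  have hsum : MemLp (fun x => ∑ w, c w * g w (φ x)) ⊤ (volume.restrict V) :=
    memLp_finsetSum _ fun w _ => (memLp_top_comp_affineEquiv φ (hg_top w)).const_mul (c w)
  have hf_top := memLp_top_comp_affineEquiv φ (hf.memLp (isOpen_image_affineEquiv φ hV))
  refine ⟨_, ⟨locallyIntegrableOn_of_memLp_top hf_top, locallyIntegrableOn_of_memLp_top hsum,
    fun ψ hψ hψc hψs => ?_⟩, hsum⟩
  let e := (AffineEquiv.toContinuousAffineEquiv φ).toHomeomorph.symm
  have hψ' : ContDiff ℝ ∞ (ψ ∘ e) := hψ.comp (contDiff_affineEquiv φ.symm)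
  have hsupp : tsupport (ψ ∘ e) ⊆ φ '' V := by
    rw [tsupport_comp_eq_preimage]
    exact fun y hy => ⟨e y, hψs hy, φ.apply_symm_apply y⟩
  have hpull : ψ = (ψ ∘ e) ∘ φ := by
    ext x
    exact congrArg ψ (φ.symm_apply_apply x).symm
  conv_lhs => rw [hpull]
  conv_rhs => rw [hpull]
  simp only [hc _ hψ']
  exact setIntegral_comp_affineEquiv_mul φ hV hg hψ' (hψc.comp_homeomorph e) hsupp

end WeakDeriv

/-! ### Mollification -/

section Mollification

variable {U : Set R3} {α : Fin 3 → ℕ} {a g : R3 → ℝ} {M : ℝ}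

lemma multiDeriv_convolution {F φ : R3 → ℝ} (hF : LocallyIntegrable F) (hφ : ContDiff ℝ ∞ φ)
    (hc : HasCompactSupport φ) (L : ℝ →L[ℝ] ℝ →L[ℝ] ℝ) (α : Fin 3 → ℕ) :
    multiDeriv α (F ⋆[L] φ) = F ⋆[L] multiDeriv α φ := by
  refine (multiDeriv_induction
    (R := fun f φ => (ContDiff ℝ ∞ φ ∧ HasCompactSupport φ) ∧ f = F ⋆[L] φ)
    (fun i f φ h => ?_) α ⟨⟨hφ, hc⟩, rfl⟩).2
  obtain ⟨⟨hφ, hc⟩, rfl⟩ := h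
  refine ⟨⟨contDiffOn_univ.1 (pderiv_contDiffOn isOpen_univ hφ.contDiffOn i),
    hc.fderiv_apply ℝ _⟩, funext fun x => ?_⟩
  rw [pderiv, (hc.hasFDerivAt_convolution_right L hF (hφ.of_le (by simp)) x).fderiv]
  exact convolution_precompR_apply L hF (hc.fderiv ℝ) (hφ.continuous_fderiv (by simp)) x _

/-- The mollification by the bump function `φ` of the extension by zero of `a` from `U`. -/
noncomputable def mollify (φ : ContDiffBump (0 : R3)) (U : Set R3) (a : R3 → ℝ) : R3 → ℝ :=
  φ.normed volume ⋆[ContinuousLinearMap.lsmul ℝ ℝ, volume] U.indicator a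

lemma contDiff_mollify (φ : ContDiffBump (0 : R3)) (ha : LocallyIntegrable (U.indicator a)) :
    ContDiff ℝ ∞ (mollify φ U a) :=
  φ.hasCompactSupport_normed.contDiff_convolution_left _ φ.contDiff_normed ha

lemma tsupport_normed_comp_sub_subset (φ : ContDiffBump (0 : R3)) (x : R3) :
    tsupport (fun t => φ.normed volume (x + (-1 : ℝ) • t)) ⊆ Metric.closedBall x φ.rOut := by
  refine closure_minimal (fun t ht => ?_) Metric.isClosed_closedBall
  have hmem : x + (-1 : ℝ) • t ∈ tsupport (φ.normed volume) := subset_tsupport _ ht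
  rw [φ.tsupport_normed_eq, mem_closedBall_zero_iff] at hmem
  rw [mem_closedBall_iff_norm']
  simpa [sub_eq_add_neg] using hmem

lemma multiDeriv_mollify_eq_setIntegral (hU : IsOpen U) (h : HasWeakDeriv α a g U)
    (ha : LocallyIntegrable (U.indicator a)) (φ : ContDiffBump (0 : R3)) {x : R3}
    (hx : Metric.closedBall x φ.rOut ⊆ U) :
    multiDeriv α (mollify φ U a) x = ∫ t in U, g t * φ.normed volume (x + (-1 : ℝ) • t) := by
  have hφ : ContDiff ℝ ∞ (φ.normed volume) := φ.contDiff_normed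
  set ψ : R3 → ℝ := fun t => φ.normed volume (x + (-1 : ℝ) • t) with hψ_def
  have hψ : ContDiff ℝ ∞ ψ := by fun_prop
  have hψs := tsupport_normed_comp_sub_subset φ x
  have hψc : HasCompactSupport ψ :=
    (isCompact_closedBall x φ.rOut).of_isClosed_subset (isClosed_tsupport _) hψs
  have hsign : ((-1 : ℝ) ^ ∑ i, α i) * (-1) ^ ∑ i, α i = 1 := by rw [← mul_pow]; simp
  have hderiv (t : R3) : multiDeriv α (φ.normed volume) (x - t) =
      (-1) ^ (∑ i, α i) * multiDeriv α ψ t := by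
    rw [hψ_def, multiDeriv_comp_homothety hφ, ← mul_assoc, hsign, one_mul, neg_one_smul,
      sub_eq_add_neg]
  calc multiDeriv α (mollify φ U a) x
      = ∫ t, U.indicator a t * multiDeriv α (φ.normed volume) (x - t) := by
        rw [mollify, ← convolution_flip,
          multiDeriv_convolution ha hφ φ.hasCompactSupport_normed, convolution_def]
        simp [mul_comm]
    _ = ∫ t, U.indicator (fun t => (-1) ^ (∑ i, α i) * (a t * multiDeriv α ψ t)) t := by
        congr 1 with t
        by_cases ht : t ∈ U <;> simp [ht, hderiv, mul_left_comm]
    _ = ∫ t in U, g t * ψ t := by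
        rw [integral_indicator hU.measurableSet, integral_const_mul,
          h.2.2 ψ hψ hψc (hψs.trans hx), ← mul_assoc, hsign, one_mul]

lemma abs_multiDeriv_mollify_le (hU : IsOpen U) (h : HasWeakDeriv α a g U)
    (hM : ∀ᵐ x ∂volume.restrict U, |g x| ≤ M) (ha : LocallyIntegrable (U.indicator a))
    (φ : ContDiffBump (0 : R3)) {x : R3} (hx : Metric.closedBall x φ.rOut ⊆ U) :
    |multiDeriv α (mollify φ U a) x| ≤ M := by
  rw [multiDeriv_mollify_eq_setIntegral hU h ha φ hx]
  set ψ : R3 → ℝ := fun t => φ.normed volume (x + (-1 : ℝ) • t)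
  have hψs := tsupport_normed_comp_sub_subset φ x
  have hψ_nonneg (t : R3) : 0 ≤ ψ t := φ.nonneg_normed _
  have hψ_int : Integrable ψ :=
    (show Continuous ψ from φ.continuous_normed.comp (by fun_prop)).integrable_of_hasCompactSupport
      ((isCompact_closedBall x φ.rOut).of_isClosed_subset (isClosed_tsupport _) hψs)
  have hmass : ∫ t in U, ψ t = 1 := by
    rw [setIntegral_eq_integral_of_forall_compl_eq_zero fun t ht =>
      image_eq_zero_of_notMem_tsupport fun h' => ht (hx (hψs h'))]
    simpa [ψ, sub_eq_add_neg] using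
      (integral_sub_left_eq_self (φ.normed volume) volume x).trans φ.integral_normed
  calc |∫ t in U, g t * ψ t| ≤ ∫ t in U, M * ψ t := by
        rw [← Real.norm_eq_abs]
        refine norm_integral_le_of_norm_le (hψ_int.integrableOn.const_mul M) ?_
        filter_upwards [hM] with t ht
        rw [norm_mul, Real.norm_eq_abs, Real.norm_of_nonneg (hψ_nonneg t)]
        exact mul_le_mul_of_nonneg_right ht (hψ_nonneg t)
    _ = M := by rw [integral_const_mul, hmass, mul_one]

lemma tendsto_mollify {φ : ℕ → ContDiffBump (0 : R3)} {y : ℕ → R3} {x : R3} (hU : IsOpen U)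
    (ha : ContinuousOn a U) (ha' : LocallyIntegrable (U.indicator a)) (hx : x ∈ U)
    (hφ : Tendsto (fun j => (φ j).rOut) atTop (𝓝 0)) (hy : Tendsto y atTop (𝓝 x)) :
    Tendsto (fun j => mollify (φ j) U a (y j)) atTop (𝓝 (a x)) := by
  refine ContDiffBump.convolution_tendsto_right (φ := φ) (g := fun _ => U.indicator a) hφ
    (Eventually.of_forall fun _ => ha'.aestronglyMeasurable) ?_ hy
  have hcont : ContinuousAt (U.indicator a) x :=
    (ha.continuousAt (hU.mem_nhds hx)).congr
      (eventuallyEq_of_mem (hU.mem_nhds hx) fun y hy => (indicator_of_mem hy a).symm)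
  have htendsto := hcont.tendsto
  rw [indicator_of_mem hx] at htendsto
  exact htendsto.comp tendsto_snd

lemma closedBall_subset_of_convex {E : Type*} [NormedAddCommGroup E] [NormedSpace ℝ E]
    {U : Set E} (hU : Convex ℝ U) {x₀ x : E} {ρ δ r : ℝ} (hx : x ∈ U)
    (hρ : Metric.ball x₀ ρ ⊆ U) (hδ : 0 < δ) (hδ1 : δ ≤ 1) (hr : r < δ * ρ) :
    Metric.closedBall (δ • x₀ + (1 - δ) • x) r ⊆ U := by
  intro y hy
  rw [mem_closedBall_iff_norm] at hy
  set e := y - (δ • x₀ + (1 - δ) • x) with he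
  have hmem : x₀ + δ⁻¹ • e ∈ U := hρ (by
    rw [mem_ball_iff_norm, add_sub_cancel_left, norm_smul, norm_inv, Real.norm_of_nonneg hδ.le,
      inv_mul_lt_iff₀ hδ]
    exact hy.trans_lt hr)
  have hy' : δ • (x₀ + δ⁻¹ • e) + (1 - δ) • x = y := by
    rw [smul_add, smul_inv_smul₀ hδ.ne', he]
    abel
  exact hy' ▸ hU hmem hx hδ.le (sub_nonneg.2 hδ1) (by ring)

lemma abs_multiDeriv_mollify_homothety_le (hU : IsOpen U) (hconv : Convex ℝ U)
    (h : HasWeakDeriv α a g U) (hM : ∀ᵐ x ∂volume.restrict U, |g x| ≤ M)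
    (ha : LocallyIntegrable (U.indicator a)) (φ : ContDiffBump (0 : R3)) {x₀ x : R3} {ρ δ : ℝ}
    (hx : x ∈ U) (hρ : Metric.ball x₀ ρ ⊆ U) (hδ : 0 < δ) (hδ1 : δ ≤ 1) (hφ : φ.rOut < δ * ρ) :
    |multiDeriv α (fun x => mollify φ U a (δ • x₀ + (1 - δ) • x)) x| ≤ M := by
  have hle := abs_multiDeriv_mollify_le hU h hM ha φ
    (closedBall_subset_of_convex hconv hx hρ hδ hδ1 hφ)
  rw [multiDeriv_comp_homothety (contDiff_mollify φ ha), abs_mul, abs_pow,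
    abs_of_nonneg (sub_nonneg.2 hδ1)]
  exact (mul_le_of_le_one_left (abs_nonneg _)
    (pow_le_one₀ (sub_nonneg.2 hδ1) (sub_le_self 1 hδ.le))).trans hle

/-- Mollifying directly would involve values outside `U`; contracting towards `x₀` first makes
room for the mollification. -/
lemma exists_smooth_approx (hU : IsOpen U) (hconv : Convex ℝ U) (hvol : volume U ≠ ⊤)
    (hne : U.Nonempty) {n : ℕ} {g : (Fin 3 → ℕ) → R3 → ℝ} {B : ℝ}
    (hcont : ContinuousOn a U) (hB : ∀ x ∈ U, |a x| ≤ B)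
    (hw : ∀ α : Fin 3 → ℕ, ∑ i, α i = n → HasWeakDeriv α a (g α) U)
    (hM : ∀ α : Fin 3 → ℕ, ∑ i, α i = n → ∀ᵐ x ∂volume.restrict U, |g α x| ≤ M) :
    ∃ G : ℕ → R3 → ℝ, (∀ j, ContDiff ℝ ∞ (G j)) ∧ (∀ j, ∀ x ∈ U, |G j x| ≤ B) ∧
      (∀ j, ∀ α : Fin 3 → ℕ, ∑ i, α i = n → ∀ x ∈ U, |multiDeriv α (G j) x| ≤ M) ∧
      ∀ x ∈ U, Tendsto (fun j => G j x) atTop (𝓝 (a x)) := by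
  obtain ⟨x₀, hx₀⟩ := hne
  obtain ⟨ρ, hρ, hball⟩ := Metric.isOpen_iff.1 hU x₀ hx₀
  have hBae : ∀ᵐ x ∂volume.restrict U, |a x| ≤ B :=
    ae_restrict_of_forall_mem hU.measurableSet hB
  have haU : IntegrableOn a U := IntegrableOn.of_bound (lt_top_iff_ne_top.2 hvol)
    (hcont.aestronglyMeasurable hU.measurableSet) B hBae
  have ha : LocallyIntegrable (U.indicator a) :=
    ((integrable_indicator_iff hU.measurableSet).2 haU).locallyIntegrable
  set δ : ℕ → ℝ := fun j => 1 / ((j : ℝ) + 1)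
  have hδ (j : ℕ) : 0 < δ j := Nat.one_div_pos_of_nat
  have hδ1 (j : ℕ) : δ j ≤ 1 := div_le_one_of_le₀ (by simp) (by positivity)
  have hδ_lim : Tendsto δ atTop (𝓝 0) := tendsto_one_div_add_atTop_nhds_zero_nat
  have hδρ (j : ℕ) : 0 < δ j * ρ / 2 := half_pos (mul_pos (hδ j) hρ)
  let φ (j : ℕ) : ContDiffBump (0 : R3) :=
    ⟨δ j * ρ / 2 / 2, δ j * ρ / 2, half_pos (hδρ j), half_lt_self (hδρ j)⟩
  have hφ (j : ℕ) : (φ j).rOut < δ j * ρ := half_lt_self (mul_pos (hδ j) hρ)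
  refine ⟨fun j x => mollify (φ j) U a (δ j • x₀ + (1 - δ j) • x),
    fun j => (contDiff_mollify (φ j) ha).comp (by fun_prop), fun j x hx => ?_,
    fun j α hα x hx => ?_, fun x hx => tendsto_mollify hU hcont ha hx ?_ ?_⟩
  · exact abs_multiDeriv_mollify_homothety_le hU hconv
      (hasWeakDeriv_zero haU.locallyIntegrableOn) hBae ha _ hx hball (hδ j) (hδ1 j) (hφ j)
  · exact abs_multiDeriv_mollify_homothety_le hU hconv (hw α hα) (hM α hα) ha _ hx hball
      (hδ j) (hδ1 j) (hφ j)
  · simpa using (hδ_lim.mul_const ρ).div_const 2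
  · simpa using (hδ_lim.smul_const x₀).add (((tendsto_const_nhds (x := 1)).sub hδ_lim).smul_const x)

end Mollification

/-! ### Taylor polynomials -/

section Taylor

variable {U : Set R3} {f : R3 → ℝ}

lemma exists_mvPolynomial_eval_eq_iteratedFDeriv (hf : ContDiff ℝ ∞ f) (x₀ : R3) (n : ℕ) :
    ∃ p : MvPolynomial (Fin 3) ℝ, p.totalDegree ≤ n ∧
      ∀ x, MvPolynomial.eval x p = iteratedFDeriv ℝ n f x₀ fun _ => x - x₀ := by
  refine ⟨∑ w : Fin n → Fin 3, (∏ j, (MvPolynomial.X (w j) - MvPolynomial.C (x₀ (w j)))) *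
    MvPolynomial.C (multiDeriv (coordCount w) f x₀),
    MvPolynomial.totalDegree_finsetSum_le fun w _ => ?_, fun x => ?_⟩
  · calc _ ≤ (∏ j, (MvPolynomial.X (w j) - MvPolynomial.C (x₀ (w j)))).totalDegree + 0 :=
          (MvPolynomial.totalDegree_mul _ _).trans (by rw [MvPolynomial.totalDegree_C])
      _ ≤ ∑ j : Fin n, 1 := (MvPolynomial.totalDegree_finsetProd _ _).trans
          (Finset.sum_le_sum fun j _ => (MvPolynomial.totalDegree_sub_C_le _ _).trans
            (MvPolynomial.totalDegree_X _).le)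
      _ = n := by simp
  · rw [iteratedFDeriv_apply_eq_sum_multiDeriv isOpen_univ hf.contDiffOn _ (mem_univ x₀)]
    simp

lemma abs_iteratedFDeriv_apply_le {n : ℕ} (hf : ContDiff ℝ ∞ f) {M R : ℝ} {x d : R3}
    (hM : ∀ α : Fin 3 → ℕ, ∑ i, α i = n → |multiDeriv α f x| ≤ M) (hd : ‖d‖ ≤ R) :
    |iteratedFDeriv ℝ n f x fun _ => d| ≤ (3 * R) ^ n * M := by
  have hR : 0 ≤ R := (norm_nonneg d).trans hd
  rw [iteratedFDeriv_apply_eq_sum_multiDeriv isOpen_univ hf.contDiffOn _ (mem_univ x)]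
  calc _ ≤ ∑ _w : Fin n → Fin 3, R ^ n * M := by
        refine (Finset.abs_sum_le_sum_abs _ _).trans (Finset.sum_le_sum fun w _ => ?_)
        have hprod : ∏ j, |d (w j)| ≤ R ^ n := by
          simpa using Finset.prod_le_prod (s := Finset.univ) (fun j _ => abs_nonneg (d (w j)))
            fun j _ => (norm_le_pi_norm d (w j)).trans hd
        rw [abs_mul, Finset.abs_prod]
        exact mul_le_mul hprod (hM _ (sum_coordCount w)) (abs_nonneg _) (pow_nonneg hR n)
    _ = (3 * R) ^ n * M := by simp [mul_pow, mul_assoc]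

lemma abs_sub_sum_iteratedFDeriv_le (hconv : Convex ℝ U) {x₀ x : R3} (hx₀ : x₀ ∈ U) (hx : x ∈ U)
    {R : ℝ} (hR : ‖x - x₀‖ ≤ R) {m : ℕ} (hf : ContDiff ℝ ∞ f) {M : ℝ}
    (hM : ∀ α : Fin 3 → ℕ, ∑ i, α i = m + 1 → ∀ x ∈ U, |multiDeriv α f x| ≤ M) :
    |f x - ∑ k ∈ Finset.range (m + 1),
      (k.factorial : ℝ)⁻¹ • iteratedFDeriv ℝ k f x₀ fun _ => x - x₀| ≤ (3 * R) ^ (m + 1) * M := by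
  have hrem : ∀ t ∈ uIoc (0 : ℝ) 1,
      ‖(1 - t) ^ m • iteratedFDeriv ℝ (m + 1) f (x₀ + t • (x - x₀)) fun _ => x - x₀‖ ≤
        (3 * R) ^ (m + 1) * M := by
    intro t ht
    rw [uIoc_of_le zero_le_one] at ht
    have hmem := hconv.add_smul_sub_mem hx₀ hx ⟨ht.1.le, ht.2⟩
    rw [norm_smul, norm_pow, Real.norm_of_nonneg (sub_nonneg.2 ht.2)]
    exact (mul_le_of_le_one_left (norm_nonneg _)
      (pow_le_one₀ (sub_nonneg.2 ht.2) (sub_le_self 1 ht.1.le))).trans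
        (abs_iteratedFDeriv_apply_le hf (fun α hα => hM α hα _ hmem) hR)
  have htaylor := map_add_eq_sum_add_integral_iteratedFDeriv (f := f) (x := x₀) (y := x - x₀)
    (n := m) fun t _ => (hf.of_le (by exact_mod_cast le_top)).contDiffAt
  have h_int := intervalIntegral.norm_integral_le_of_norm_le_const hrem
  rw [sub_zero, abs_one, mul_one] at h_int
  rw [add_sub_cancel] at htaylor
  rw [htaylor, add_sub_cancel_left, smul_eq_mul, abs_mul,
    abs_of_nonneg (by positivity : (0 : ℝ) ≤ (m.factorial : ℝ)⁻¹)]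
  exact (mul_le_of_le_one_left (abs_nonneg _)
    (inv_le_one_of_one_le₀ (mod_cast m.factorial_pos))).trans h_int

lemma exists_mvPolynomial_abs_sub_eval_le (hconv : Convex ℝ U) {x₀ : R3} (hx₀ : x₀ ∈ U) {R : ℝ}
    (hR : ∀ x ∈ U, ‖x - x₀‖ ≤ R) {m : ℕ} (hf : ContDiff ℝ ∞ f) {M : ℝ}
    (hM : ∀ α : Fin 3 → ℕ, ∑ i, α i = m + 1 → ∀ x ∈ U, |multiDeriv α f x| ≤ M) :
    ∃ p : MvPolynomial (Fin 3) ℝ, p.totalDegree ≤ m ∧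
      ∀ x ∈ U, |f x - MvPolynomial.eval x p| ≤ (3 * R) ^ (m + 1) * M := by
  choose p hp hpeval using exists_mvPolynomial_eval_eq_iteratedFDeriv hf x₀
  refine ⟨∑ k ∈ Finset.range (m + 1), (k.factorial : ℝ)⁻¹ • p k,
    MvPolynomial.totalDegree_finsetSum_le fun k hk => (MvPolynomial.totalDegree_smul_le _ _).trans
      ((hp k).trans (Finset.mem_range_succ_iff.1 hk)), fun x hx => ?_⟩
  simpa [MvPolynomial.smul_eval, hpeval] using
    abs_sub_sum_iteratedFDeriv_le hconv hx₀ hx (hR x hx) hf hM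

end Taylor

/-! ### Gauss–Jacobi quadrature -/

section GaussJacobi

open Polynomial

variable {n a b : ℕ}

lemma choose_mul_descFactorial_mul_descFactorial {n j : ℕ} (h : j ≤ n) (A B : ℕ) :
    n.choose j * (A.descFactorial (n - j) * B.descFactorial j) =
      n.factorial * (A.choose (n - j) * B.choose j) := by
  rw [Nat.descFactorial_eq_factorial_mul_choose, Nat.descFactorial_eq_factorial_mul_choose,
    ← Nat.choose_mul_factorial_mul_factorial h]
  ring

lemma iterate_derivative_eq_factorial_smul_jacobiPoly (n a b : ℕ) :
    derivative^[n] ((X - 1 : ℝ[X]) ^ (n + a) * X ^ (n + b)) =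
      n.factorial • ((X - 1) ^ a * X ^ b * jacobiPoly n a b) := by
  rw [iterate_derivative_mul, jacobiPoly, Finset.mul_sum, Finset.smul_sum]
  refine Finset.sum_congr rfl fun j hj => ?_
  have hjn : j ≤ n := Finset.mem_range_succ_iff.1 hj
  have hX : derivative^[n - j] ((X - 1 : ℝ[X]) ^ (n + a)) =
      (n + a).descFactorial (n - j) • (X - 1) ^ (a + j) := by
    rw [← C_1, iterate_derivative_X_sub_pow, (by omega : n + a - (n - j) = a + j)]
  have hcoeff := congr_arg (Nat.cast (R := ℝ[X]))
    (choose_mul_descFactorial_mul_descFactorial hjn (n + a) (n + b))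
  rw [hX, iterate_derivative_X_pow_eq_natCast_mul, (by omega : n + b - j = b + (n - j))]
  simp only [nsmul_eq_mul, map_natCast]
  push_cast at hcoeff ⊢
  linear_combination ((X - 1) ^ (a + j) * X ^ (b + (n - j))) * hcoeff

lemma jacobiPoly_ne_zero (n a b : ℕ) : jacobiPoly n a b ≠ 0 := by
  have heval : (jacobiPoly n a b).eval 1 = ((n + a).choose n : ℝ) := by
    rw [jacobiPoly, eval_finsetSum, Finset.sum_eq_single 0 (fun j _ hj => by simp [hj]) (by simp)]
    simp
  rintro h
  rw [h, eval_zero, eq_comm, Nat.cast_eq_zero] at heval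
  exact (Nat.choose_pos (Nat.le_add_right n a)).ne' heval

lemma natDegree_jacobiPoly_le (n a b : ℕ) : (jacobiPoly n a b).natDegree ≤ n := by
  refine natDegree_sum_le_of_forall_le _ _ fun j hj => ?_
  have hjn : j ≤ n := Finset.mem_range_succ_iff.1 hj
  rw [← C_1]
  compute_degree
  omega

/-- The integral over `[0,1]` against the Jacobi weight `(1-t)^a t^b`, as a linear form. -/
noncomputable def jacobiIntegral (a b : ℕ) : ℝ[X] →ₗ[ℝ] ℝ where
  toFun f := ∫ t in (0 : ℝ)..1, (1 - t) ^ a * t ^ b * f.eval t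
  map_add' f g := by
    simp only [eval_add, mul_add]
    exact intervalIntegral.integral_add (Continuous.intervalIntegrable (by fun_prop) _ _)
      (Continuous.intervalIntegrable (by fun_prop) _ _)
  map_smul' c f := by
    simp only [eval_smul, smul_eq_mul, RingHom.id_apply, ← intervalIntegral.integral_const_mul]
    congr 1 with t
    ring

lemma jacobiIntegral_apply (f : ℝ[X]) :
    jacobiIntegral a b f = ∫ t in (0 : ℝ)..1, (1 - t) ^ a * t ^ b * f.eval t := rfl

lemma eval_iterate_derivative_eq_zero {R : Type*} [CommRing R] {G : R[X]} {x : R} {i : ℕ}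
    (h : (X - C x) ^ n ∣ G) (hi : i < n) : (derivative^[i] G).eval x = 0 :=
  dvd_iff_isRoot.1 ((dvd_pow_self _ (Nat.sub_ne_zero_of_lt hi)).trans
    (pow_sub_dvd_iterate_derivative_of_pow_dvd i h))

lemma integral_mul_iterate_derivative_eq_zero {u v : ℝ} {G : ℝ[X]} (hu : (X - C u) ^ n ∣ G)
    (hv : (X - C v) ^ n ∣ G) {i : ℕ} (hi : i ≤ n) {q : ℝ[X]} (hq : q.degree < i) :
    ∫ t in u..v, q.eval t * (derivative^[i] G).eval t = 0 := by
  induction i generalizing q with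
  | zero => simp [show q = 0 by simpa using hq]
  | succ i ih =>
    have hparts := intervalIntegral.integral_mul_deriv_eq_deriv_mul (a := u) (b := v)
      (u := fun t => q.eval t) (v := fun t => (derivative^[i] G).eval t)
      (u' := fun t => (derivative q).eval t) (v' := fun t => (derivative^[i + 1] G).eval t)
      (fun t _ => q.hasDerivAt t)
      (fun t _ => by rw [Function.iterate_succ_apply']; exact Polynomial.hasDerivAt _ t)
      ((Polynomial.continuous _).intervalIntegrable _ _)
      ((Polynomial.continuous _).intervalIntegrable _ _)
    have hq' : (derivative q).degree < i := by
      rcases eq_or_ne q 0 with rfl | hq0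
      · simp
      · exact (degree_derivative_lt hq0).trans_le (Order.lt_succ_iff.1 hq)
    rw [hparts, eval_iterate_derivative_eq_zero hu hi, eval_iterate_derivative_eq_zero hv hi,
      ih (Nat.le_of_succ_le hi) hq', mul_zero, mul_zero, sub_zero, sub_zero]

lemma jacobiIntegral_jacobiPoly_mul_eq_zero {q : ℝ[X]} (hq : q.degree < n) :
    jacobiIntegral a b (jacobiPoly n a b * q) = 0 := by
  have h := integral_mul_iterate_derivative_eq_zero (u := 0) (v := 1)
    (G := (X - 1) ^ (n + a) * X ^ (n + b))
    (by simpa using Dvd.dvd.mul_left (pow_dvd_pow _ (Nat.le_add_right n b)) _)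
    (by simpa using Dvd.dvd.mul_right (pow_dvd_pow _ (Nat.le_add_right n a)) _) le_rfl hq
  rw [iterate_derivative_eq_factorial_smul_jacobiPoly] at h
  have hc : (-1) ^ a * (n.factorial : ℝ) ≠ 0 := by positivity
  rw [← mul_right_inj' hc, mul_zero, ← h, jacobiIntegral_apply,
    ← intervalIntegral.integral_const_mul]
  congr 1 with t
  have hsign : (-1) ^ a * (1 - t) ^ a = (t - 1) ^ a := by rw [← mul_pow, neg_one_mul, neg_sub]
  simp only [eval_mul, eval_pow, eval_sub, eval_one, eval_X, nsmul_eq_mul, eval_natCast]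
  linear_combination (n.factorial * t ^ b * eval t (jacobiPoly n a b) * eval t q) * hsign

lemma exists_finset_nonneg_mul_prod_X_sub_C (u v : ℝ) {f : ℝ[X]} (hf : f ≠ 0) :
    ∃ R : Finset ℝ, (∀ x ∈ R, x ∈ Ioo u v ∧ f.IsRoot x) ∧ ∃ c : ℝ, c ≠ 0 ∧
      ∀ t ∈ Ioo u v, 0 ≤ (C c * (f * ∏ x ∈ R, (X - C x))).eval t := by
  induction hn : f.natDegree using Nat.strong_induction_on generalizing f with
  | _ n ih
  by_cases hr : ∃ x ∈ Ioo u v, f.IsRoot x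
  · obtain ⟨x, hx, hfx⟩ := hr
    obtain ⟨g, rfl⟩ := dvd_iff_isRoot.2 hfx
    have hg : g ≠ 0 := right_ne_zero_of_mul hf
    obtain ⟨R, hR, c, hc, hnonneg⟩ := ih g.natDegree
      (by rw [← hn, natDegree_mul (X_sub_C_ne_zero x) hg, natDegree_X_sub_C]; omega) hg rfl
    have hR' (y : ℝ) (hy : y ∈ R) : y ∈ Ioo u v ∧ ((X - C x) * g).IsRoot y :=
      ⟨(hR y hy).1, root_mul_left_of_isRoot _ (hR y hy).2⟩
    by_cases hxR : x ∈ R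
    · refine ⟨R.erase x, fun y hy => hR' y (Finset.mem_of_mem_erase hy), c, hc, ?_⟩
      rwa [mul_comm _ g, mul_assoc g, Finset.mul_prod_erase R (fun y => X - C y) hxR]
    · refine ⟨insert x R, fun y hy => ?_, c, hc, fun t ht => ?_⟩
      · rcases Finset.mem_insert.1 hy with rfl | hy
        exacts [⟨hx, hfx⟩, hR' y hy]
      · have hsq : C c * ((X - C x) * g * ∏ y ∈ insert x R, (X - C y)) =
            (X - C x) ^ 2 * (C c * (g * ∏ y ∈ R, (X - C y))) := by
          rw [Finset.prod_insert hxR]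
          ring
        rw [hsq, eval_mul, eval_pow]
        exact mul_nonneg (sq_nonneg _) (hnonneg t ht)
  · push Not at hr
    suffices h : (∀ t ∈ Ioo u v, 0 ≤ f.eval t) ∨ ∀ t ∈ Ioo u v, f.eval t ≤ 0 by
      rcases h with h | h
      · exact ⟨∅, by simp, 1, one_ne_zero, by simpa using h⟩
      · exact ⟨∅, by simp, -1, by norm_num, by simpa using h⟩
    by_contra! ⟨⟨s, hs, hs'⟩, t, ht, ht'⟩
    obtain ⟨x, hx, hx'⟩ := isPreconnected_Ioo.intermediate_value hs ht
      f.continuous.continuousOn ⟨hs'.le, ht'.le⟩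
    exact hr x hx hx'

lemma eq_zero_of_jacobiIntegral_eq_zero {f : ℝ[X]} (h : jacobiIntegral a b f = 0)
    (hf : ∀ t ∈ Ioo (0 : ℝ) 1, 0 ≤ f.eval t) : f = 0 := by
  have hweight : ∀ t ∈ Ioo (0 : ℝ) 1, 0 < (1 - t) ^ a * t ^ b := fun t ht =>
    mul_pos (pow_pos (sub_pos.2 ht.2) a) (pow_pos ht.1 b)
  have hcont : Continuous fun t : ℝ => (1 - t) ^ a * t ^ b * f.eval t := by fun_prop
  rw [jacobiIntegral_apply, intervalIntegral.integral_of_le zero_le_one,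
    integral_Ioc_eq_integral_Ioo, setIntegral_eq_zero_iff_of_nonneg_ae
      (ae_restrict_of_forall_mem measurableSet_Ioo fun t ht =>
        mul_nonneg (hweight t ht).le (hf t ht))
      (hcont.integrableOn_Icc.mono_set Ioo_subset_Icc_self)] at h
  have hzero := Measure.eqOn_open_of_ae_eq h isOpen_Ioo hcont.continuousOn continuousOn_const
  exact eq_zero_of_infinite_isRoot f ((Ioo_infinite zero_lt_one).mono fun t ht =>
    (mul_eq_zero.1 (hzero ht)).resolve_left (hweight t ht).ne')

lemma mem_gaussNodes {x : ℝ} : x ∈ gaussNodes n a b ↔ (jacobiPoly n a b).IsRoot x := by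
  rw [gaussNodes, Multiset.mem_toFinset, mem_roots (jacobiPoly_ne_zero n a b)]

lemma card_gaussNodes_le_natDegree : (gaussNodes n a b).card ≤ (jacobiPoly n a b).natDegree :=
  (Multiset.toFinset_card_le _).trans (card_roots' _)

/-- Otherwise the product over `R` would have degree less than `n`, hence be orthogonal to the
Jacobi polynomial, although their product has constant sign. -/
lemma le_card_of_nonneg_jacobiPoly_mul_prod {R : Finset ℝ} {c : ℝ} (hc : c ≠ 0)
    (h : ∀ t ∈ Ioo (0 : ℝ) 1, 0 ≤ (C c * (jacobiPoly n a b * ∏ x ∈ R, (X - C x))).eval t) :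
    n ≤ R.card := by
  by_contra! hlt
  have hprod : (∏ x ∈ R, (X - C x) : ℝ[X]) ≠ 0 :=
    Finset.prod_ne_zero_iff.2 fun x _ => X_sub_C_ne_zero x
  have hdeg : (∏ x ∈ R, (X - C x) : ℝ[X]).degree < n := by
    rw [degree_eq_natDegree hprod, natDegree_finsetProd_X_sub_C_eq_card]
    exact_mod_cast hlt
  refine mul_ne_zero (C_ne_zero.2 hc) (mul_ne_zero (jacobiPoly_ne_zero n a b) hprod)
    (eq_zero_of_jacobiIntegral_eq_zero (a := a) (b := b) ?_ h)
  rw [C_mul', map_smul, jacobiIntegral_jacobiPoly_mul_eq_zero hdeg, smul_zero]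

lemma exists_subset_gaussNodes_card_ge (n a b : ℕ) :
    ∃ R ⊆ gaussNodes n a b, (∀ x ∈ R, x ∈ Ioo (0 : ℝ) 1) ∧ n ≤ R.card := by
  obtain ⟨R, hR, c, hc, h⟩ := exists_finset_nonneg_mul_prod_X_sub_C 0 1 (jacobiPoly_ne_zero n a b)
  exact ⟨R, fun x hx => mem_gaussNodes.2 (hR x hx).2, fun x hx => (hR x hx).1,
    le_card_of_nonneg_jacobiPoly_mul_prod hc h⟩

lemma card_gaussNodes (n a b : ℕ) : (gaussNodes n a b).card = n := by
  obtain ⟨R, hR, -, hn⟩ := exists_subset_gaussNodes_card_ge n a b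
  exact le_antisymm (card_gaussNodes_le_natDegree.trans (natDegree_jacobiPoly_le n a b))
    (hn.trans (Finset.card_le_card hR))

lemma natDegree_jacobiPoly (n a b : ℕ) : (jacobiPoly n a b).natDegree = n :=
  le_antisymm (natDegree_jacobiPoly_le n a b)
    ((card_gaussNodes n a b).ge.trans card_gaussNodes_le_natDegree)

lemma gaussNodes_mem_Ioo {x : ℝ} (hx : x ∈ gaussNodes n a b) : x ∈ Ioo (0 : ℝ) 1 := by
  obtain ⟨R, hR, hIoo, hn⟩ := exists_subset_gaussNodes_card_ge n a b
  rw [← Finset.eq_of_subset_of_card_le hR ((card_gaussNodes n a b).le.trans hn)] at hx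
  exact hIoo x hx

lemma sum_gaussWeight_mul_eval_eq_of_degree_lt {f : ℝ[X]} (hf : f.degree < n) :
    ∑ x ∈ gaussNodes n a b, gaussWeight n a b x * f.eval x = jacobiIntegral a b f := by
  conv_rhs => rw [Lagrange.eq_interpolate (f := f) (s := gaussNodes n a b) (v := id)
    Function.injective_id.injOn (by rwa [card_gaussNodes]), Lagrange.interpolate_apply, map_sum]
  refine Finset.sum_congr rfl fun x _ => ?_
  rw [C_mul', map_smul, smul_eq_mul, mul_comm]
  rfl

theorem sum_gaussWeight_mul_eval_eq {f : ℝ[X]} (hf : f.natDegree < 2 * n) :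
    ∑ x ∈ gaussNodes n a b, gaussWeight n a b x * f.eval x = jacobiIntegral a b f := by
  set P := jacobiPoly n a b with hP
  have hP0 : P ≠ 0 := jacobiPoly_ne_zero n a b
  have hdegP : P.degree = n := by rw [degree_eq_natDegree hP0, hP, natDegree_jacobiPoly]
  have hdiv : (f / P).degree < n := by
    rcases eq_or_ne (f / P) 0 with h0 | h0
    · rw [h0, degree_zero]
      exact WithBot.bot_lt_coe n
    · have hle : P.degree ≤ f.degree :=
        not_lt.1 fun hlt => h0 ((Polynomial.div_eq_zero_iff hP0).2 hlt)
      have hadd := degree_add_div hP0 hle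
      have hf0 : f ≠ 0 := fun h => h0 (by rw [h, EuclideanDomain.zero_div])
      rw [hdegP, degree_eq_natDegree h0, degree_eq_natDegree hf0] at hadd
      have hadd' : n + (f / P).natDegree = f.natDegree := by exact_mod_cast hadd
      rw [degree_eq_natDegree h0]
      exact_mod_cast (by omega : (f / P).natDegree < n)
  have hmod : (f % P).degree < n := hdegP ▸ EuclideanDomain.mod_lt f hP0
  have heval : ∀ x ∈ gaussNodes n a b, f.eval x = (f % P).eval x := fun x hx => by
    conv_lhs => rw [← EuclideanDomain.div_add_mod f P, eval_add, eval_mul,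
      (mem_gaussNodes.1 hx : P.eval x = 0), zero_mul, zero_add]
  rw [Finset.sum_congr rfl fun x hx => by rw [heval x hx],
    sum_gaussWeight_mul_eval_eq_of_degree_lt hmod]
  conv_rhs => rw [← EuclideanDomain.div_add_mod f P, map_add,
    jacobiIntegral_jacobiPoly_mul_eq_zero hdiv, zero_add]

end GaussJacobi

/-! ### The reference pyramid and the conical product rule -/

lemma refPyramid_isOpen : IsOpen refPyramid := by
  refine IsOpen.inter (isOpen_lt continuous_const (continuous_apply 2)) ?_
  refine IsOpen.inter (isOpen_lt continuous_const (continuous_apply 0)) ?_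
  refine IsOpen.inter (isOpen_lt (continuous_apply 0) (by fun_prop)) ?_
  exact IsOpen.inter (isOpen_lt continuous_const (continuous_apply 1))
    (isOpen_lt (continuous_apply 1) (by fun_prop))

lemma refPyramid_convex : Convex ℝ refPyramid := by
  rw [convex_iff_forall_pos]
  rintro x ⟨h1, h2, h3, h4, h5⟩ y ⟨g1, g2, g3, g4, g5⟩ a b ha hb hab
  simp only [refPyramid, Set.mem_ofPred_eq, Pi.add_apply, Pi.smul_apply, smul_eq_mul]
  refine ⟨by positivity, by positivity, ?_, by positivity, ?_⟩
  · linarith [mul_lt_mul_of_pos_left h3 ha, mul_lt_mul_of_pos_left g3 hb]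
  · linarith [mul_lt_mul_of_pos_left h5 ha, mul_lt_mul_of_pos_left g5 hb]

/-- A reference point of the pyramid, used as the centre of the Taylor expansions. -/
noncomputable def refPoint : R3 := fun _ => 1 / 4

lemma refPoint_mem : refPoint ∈ refPyramid := by
  norm_num [refPoint, refPyramid]

lemma norm_sub_refPoint_le {x : R3} (hx : x ∈ refPyramid) : ‖x - refPoint‖ ≤ 1 := by
  obtain ⟨h1, h2, h3, h4, h5⟩ := hx
  rw [pi_norm_le_iff_of_nonneg zero_le_one]
  intro i
  rw [Real.norm_eq_abs, abs_le]
  fin_cases i <;> simp [refPoint] <;> constructor <;> linarith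

lemma volume_refPyramid_lt_top : volume refPyramid < ⊤ := by
  have hsub : refPyramid ⊆ Metric.closedBall refPoint 1 := fun x hx =>
    mem_closedBall_iff_norm.2 (norm_sub_refPoint_le hx)
  exact (measure_mono hsub).trans_lt measure_closedBall_lt_top

lemma one_sub_pos_of_mem_refPyramid {x : R3} (hx : x ∈ refPyramid) : 0 < 1 - x 2 :=
  hx.2.1.trans hx.2.2.1

/-- The open unit cube, the domain of the Duffy coordinates. -/
def cube : Set R3 := Set.univ.pi fun _ => Set.Ioo (0 : ℝ) 1

lemma mem_cube {p : R3} : p ∈ cube ↔ ∀ i, p i ∈ Set.Ioo (0 : ℝ) 1 := by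
  simp only [cube, Set.mem_univ_pi]

lemma cube_isOpen : IsOpen cube := isOpen_set_pi Set.finite_univ fun _ _ => isOpen_Ioo

/-- The Duffy map, which collapses the top face of the cube to the apex of the pyramid. -/
def duffy (p : R3) : R3 := ![p 0 * (1 - p 2), p 1 * (1 - p 2), p 2]

/-- The inverse of the Duffy map on the reference pyramid. -/
noncomputable def unduffy (x : R3) : R3 := ![x 0 / (1 - x 2), x 1 / (1 - x 2), x 2]

lemma duffy_mem {p : R3} (hp : p ∈ cube) : duffy p ∈ refPyramid := by
  obtain ⟨h0, h0'⟩ := mem_cube.1 hp 0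
  obtain ⟨h1, h1'⟩ := mem_cube.1 hp 1
  obtain ⟨h2, h2'⟩ := mem_cube.1 hp 2
  have h3 : 0 < 1 - p 2 := sub_pos.2 h2'
  exact ⟨h2, mul_pos h0 h3, mul_lt_of_lt_one_left h3 h0', mul_pos h1 h3,
    mul_lt_of_lt_one_left h3 h1'⟩

lemma unduffy_mem {x : R3} (hx : x ∈ refPyramid) : unduffy x ∈ cube := by
  have h := one_sub_pos_of_mem_refPyramid hx
  obtain ⟨h1, h2, h3, h4, h5⟩ := hx
  rw [mem_cube]
  intro i
  fin_cases i
  · exact ⟨div_pos h2 h, (div_lt_one h).2 h3⟩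
  · exact ⟨div_pos h4 h, (div_lt_one h).2 h5⟩
  · exact ⟨h1, sub_pos.1 h⟩

lemma duffy_invOn : Set.InvOn unduffy duffy cube refPyramid := by
  constructor
  · intro p hp
    have h : 1 - p 2 ≠ 0 := (sub_pos.2 (mem_cube.1 hp 2).2).ne'
    ext i
    fin_cases i <;> simp [duffy, unduffy, h]
  · intro x hx
    have h := (one_sub_pos_of_mem_refPyramid hx).ne'
    ext i
    fin_cases i <;> simp [duffy, unduffy, h]

lemma duffy_bijOn : Set.BijOn duffy cube refPyramid :=
  duffy_invOn.bijOn (fun _ => duffy_mem) fun _ => unduffy_mem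

lemma hasFDerivAt_duffy (p : R3) :
    HasFDerivAt duffy (LinearMap.toContinuousLinearMap
      (Matrix.toLin' !![1 - p 2, 0, -p 0; 0, 1 - p 2, -p 1; 0, 0, 1])) p := by
  rw [hasFDerivAt_pi']
  intro i
  fin_cases i
  · refine ((hasFDerivAt_apply 0 p).mul ((hasFDerivAt_apply 2 p).const_sub 1)).congr_fderiv ?_
    ext v
    simp [dotProduct, Fin.sum_univ_three]
    ring
  · refine ((hasFDerivAt_apply 1 p).mul ((hasFDerivAt_apply 2 p).const_sub 1)).congr_fderiv ?_
    ext v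
    simp [dotProduct, Fin.sum_univ_three]
    ring
  · refine (hasFDerivAt_apply 2 p).congr_fderiv ?_
    ext v
    simp [dotProduct, Fin.sum_univ_three]

lemma setIntegral_refPyramid (f : R3 → ℝ) :
    ∫ x in refPyramid, f x = ∫ p in cube, (1 - p 2) ^ 2 * f (duffy p) := by
  have hdet (p : R3) : (LinearMap.toContinuousLinearMap
      (Matrix.toLin' !![1 - p 2, 0, -p 0; 0, 1 - p 2, -p 1; 0, 0, 1])).det = (1 - p 2) ^ 2 := by
    rw [ContinuousLinearMap.det, LinearMap.coe_toContinuousLinearMap, LinearMap.det_toLin',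
      Matrix.det_fin_three]
    simp
    ring
  rw [← duffy_bijOn.image_eq, integral_image_eq_integral_abs_det_fderiv_smul volume
    cube_isOpen.measurableSet (fun p _ => (hasFDerivAt_duffy p).hasFDerivWithinAt)
    duffy_bijOn.injOn]
  simp only [hdet, smul_eq_mul, abs_pow, sq_abs]

lemma setIntegral_cube_prod (f : Fin 3 → ℝ → ℝ) :
    ∫ p in cube, ∏ i, f i (p i) = ∏ i, ∫ t in (0 : ℝ)..1, f i t := by
  have hpi : (volume : Measure R3).restrict cube =
      Measure.pi fun _ : Fin 3 => (volume : Measure ℝ).restrict (Set.Ioo 0 1) := by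
    rw [volume_pi, cube, Measure.restrict_pi_pi]
  rw [hpi, integral_fintype_prod_eq_prod]
  refine Finset.prod_congr rfl fun i _ => ?_
  rw [intervalIntegral.integral_of_le zero_le_one, integral_Ioc_eq_integral_Ioo]

/-- The exponents `a` of the Jacobi weights `(1 - t) ^ a` of the conical product rule, one for each
Duffy coordinate; the third one is the Jacobian `(1 - ζ) ^ 2` of the Duffy map. -/
def conicExponent : Fin 3 → ℕ := ![0, 0, 2]

/-- The nodes of the conical product rule, in Duffy coordinates. -/
noncomputable def conicNodes (k : ℕ) : Finset R3 :=
  Fintype.piFinset fun i => gaussNodes (k + 1) (conicExponent i) 0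

/-- The weights of the conical product rule. -/
noncomputable def conicWeight (k : ℕ) (p : R3) : ℝ :=
  ∏ i, gaussWeight (k + 1) (conicExponent i) 0 (p i)

lemma quadRef_eq_sum (k : ℕ) (f : R3 → ℝ) :
    quadRef k f = ∑ p ∈ conicNodes k, conicWeight k p * f (duffy p) := by
  simp only [quadRef, ← Finset.sum_product']
  refine Finset.sum_nbij' (fun q => ![q.1, q.2.1, q.2.2]) (fun p => (p 0, p 1, p 2)) ?_ ?_
    (fun _ _ => rfl) ?_ ?_
  · rintro ⟨x, y, z⟩ h
    simpa [conicNodes, conicExponent, Fin.forall_fin_succ] using h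
  · intro p h
    simpa [conicNodes, conicExponent, Fin.forall_fin_succ] using h
  · intro p _
    ext i
    fin_cases i <;> rfl
  · rintro ⟨x, y, z⟩ _
    simp [conicWeight, conicExponent, Fin.prod_univ_three, duffy]
    ring

lemma duffy_mem_of_mem_conicNodes {k : ℕ} {p : R3} (hp : p ∈ conicNodes k) :
    duffy p ∈ refPyramid :=
  duffy_mem (mem_cube.2 fun i => gaussNodes_mem_Ioo (Fintype.mem_piFinset.1 hp i))

theorem errRef_eq_zero_of_comp_duffy_eq_prod (k : ℕ) {f : R3 → ℝ} {P : Fin 3 → ℝ[X]}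
    (hP : ∀ i, (P i).natDegree ≤ 2 * k + 1)
    (hf : ∀ p ∈ cube, f (duffy p) = ∏ i, (P i).eval (p i)) : errRef k f = 0 := by
  have hnode : quadRef k f =
      ∏ i, ∑ x ∈ gaussNodes (k + 1) (conicExponent i) 0,
        gaussWeight (k + 1) (conicExponent i) 0 x * (P i).eval x := by
    rw [quadRef_eq_sum, Finset.prod_univ_sum]
    refine Finset.sum_congr rfl fun p hp => ?_
    have hcube := mem_cube.2 fun i => gaussNodes_mem_Ioo (Fintype.mem_piFinset.1 hp i)
    rw [hf p hcube, conicWeight, Finset.prod_mul_distrib]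
  have h_int : ∫ x in refPyramid, f x = ∏ i, jacobiIntegral (conicExponent i) 0 (P i) := by
    simp only [setIntegral_refPyramid, jacobiIntegral_apply]
    rw [← setIntegral_cube_prod]
    refine setIntegral_congr_fun cube_isOpen.measurableSet fun p hp => ?_
    simp [hf p hp, conicExponent, Fin.prod_univ_three]
    ring
  rw [errRef, hnode, h_int, sub_eq_zero]
  exact Finset.prod_congr rfl fun i _ =>
    sum_gaussWeight_mul_eval_eq ((hP i).trans_lt (by omega))

lemma errRef_congr (k : ℕ) {f g : R3 → ℝ} (h : Set.EqOn f g refPyramid) :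
    errRef k f = errRef k g := by
  simp only [errRef, quadRef_eq_sum, setIntegral_congr_fun refPyramid_isOpen.measurableSet h]
  congr 1
  exact Finset.sum_congr rfl fun p hp => by rw [h (duffy_mem_of_mem_conicNodes hp)]

lemma errRef_smul (k : ℕ) (c : ℝ) (f : R3 → ℝ) : errRef k (c • f) = c * errRef k f := by
  simp only [errRef, quadRef_eq_sum, Pi.smul_apply, smul_eq_mul, integral_const_mul, mul_sub,
    Finset.mul_sum, mul_left_comm]

lemma errRef_sum {ι : Type*} (k : ℕ) (s : Finset ι) {f : ι → R3 → ℝ}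
    (hf : ∀ i ∈ s, IntegrableOn (f i) refPyramid) :
    errRef k (∑ i ∈ s, f i) = ∑ i ∈ s, errRef k (f i) := by
  simp only [errRef, quadRef_eq_sum, Finset.sum_apply, Finset.mul_sum, Finset.sum_sub_distrib]
  rw [Finset.sum_comm, integral_finsetSum _ hf]

lemma errRef_add (k : ℕ) {f g : R3 → ℝ} (hf : IntegrableOn f refPyramid)
    (hg : IntegrableOn g refPyramid) : errRef k (f + g) = errRef k f + errRef k g := by
  simp only [errRef, quadRef_eq_sum, Pi.add_apply, mul_add, Finset.sum_add_distrib]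
  rw [integral_add hf hg]
  ring

lemma exists_abs_errRef_le (k : ℕ) : ∃ C, 0 ≤ C ∧ ∀ (f : R3 → ℝ) (B : ℝ),
    (∀ x ∈ refPyramid, |f x| ≤ B) → |errRef k f| ≤ C * B := by
  refine ⟨∑ p ∈ conicNodes k, |conicWeight k p| + volume.real refPyramid, by positivity,
    fun f B hB => ?_⟩
  rw [errRef, quadRef_eq_sum, add_mul, Finset.sum_mul]
  refine (abs_sub _ _).trans (add_le_add ?_ ?_)
  · refine (Finset.abs_sum_le_sum_abs _ _).trans (Finset.sum_le_sum fun p hp => ?_)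
    rw [abs_mul]
    exact mul_le_mul_of_nonneg_left (hB _ (duffy_mem_of_mem_conicNodes hp)) (abs_nonneg _)
  · rw [mul_comm]
    exact norm_setIntegral_le_of_norm_le_const (f := f) volume_refPyramid_lt_top hB

lemma integrableOn_refPyramid {f : R3 → ℝ} {B : ℝ} (hf : ContinuousOn f refPyramid)
    (hB : ∀ x ∈ refPyramid, |f x| ≤ B) : IntegrableOn f refPyramid :=
  IntegrableOn.of_bound volume_refPyramid_lt_top
    (hf.aestronglyMeasurable refPyramid_isOpen.measurableSet) B
    (ae_restrict_of_forall_mem refPyramid_isOpen.measurableSet hB)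

lemma tendsto_errRef (k : ℕ) {F : ℕ → R3 → ℝ} {f : R3 → ℝ} {B : ℝ}
    (hF : ∀ j, ContinuousOn (F j) refPyramid) (hB : ∀ j, ∀ x ∈ refPyramid, |F j x| ≤ B)
    (hlim : ∀ x ∈ refPyramid, Tendsto (fun j => F j x) atTop (𝓝 (f x))) :
    Tendsto (fun j => errRef k (F j)) atTop (𝓝 (errRef k f)) := by
  have hmeas := refPyramid_isOpen.measurableSet
  simp only [errRef, quadRef_eq_sum]
  refine Tendsto.sub ?_ ?_
  · exact tendsto_finsetSum _ fun p hp =>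
      (hlim _ (duffy_mem_of_mem_conicNodes hp)).const_mul _
  · exact tendsto_integral_of_dominated_convergence (fun _ => B)
      (fun j => (hF j).aestronglyMeasurable hmeas)
      (integrableOn_const volume_refPyramid_lt_top.ne)
      (fun j => ae_restrict_of_forall_mem hmeas (hB j))
      (ae_restrict_of_forall_mem hmeas hlim)

/-! ### Functions homogeneous about the apex -/

/-- The apex of the reference pyramid. -/
def apex : R3 := Pi.single 2 1

lemma apex_add_smul_sub_apex (t : ℝ) (x : R3) :
    apex + t • (x - apex) = ![t * x 0, t * x 1, 1 - t * (1 - x 2)] := by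
  ext i
  fin_cases i <;> simp [apex]
  ring

/-- The half-space below the apex, on which the shape functions are smooth and which is invariant
under the homotheties about the apex. -/
def belowApex : Set R3 := {x | x 2 < 1}

lemma belowApex_isOpen : IsOpen belowApex := isOpen_lt (continuous_apply 2) continuous_const

lemma refPyramid_subset_belowApex : refPyramid ⊆ belowApex := fun _ hx =>
  sub_pos.1 (one_sub_pos_of_mem_refPyramid hx)

/-- The smooth functions on the half-space below the apex that are homogeneous of degree `d` about
the apex. -/
def conicHom (d : ℕ) : Submodule ℝ (R3 → ℝ) where
  carrier := {f | ContDiffOn ℝ ∞ f belowApex ∧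
    ∀ x ∈ belowApex, ∀ t : ℝ, 0 < t → f (apex + t • (x - apex)) = t ^ d * f x}
  add_mem' := fun hf hg => ⟨hf.1.add hg.1, fun x hx t ht => by
    simp only [Pi.add_apply, hf.2 x hx t ht, hg.2 x hx t ht, mul_add]⟩
  zero_mem' := ⟨contDiffOn_const, by simp⟩
  smul_mem' := fun c f hf => ⟨contDiffOn_const.smul hf.1, fun x hx t ht => by
    simp only [Pi.smul_apply, smul_eq_mul, hf.2 x hx t ht, mul_left_comm]⟩

section ConicHom

variable {d : ℕ} {f : R3 → ℝ}

lemma contDiffOn_of_mem_conicHom (hf : f ∈ conicHom d) : ContDiffOn ℝ ∞ f refPyramid :=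
  hf.1.mono refPyramid_subset_belowApex

lemma pderiv_mem_conicHom (hf : f ∈ conicHom (d + 1)) (i : Fin 3) : pderiv i f ∈ conicHom d := by
  have hU := belowApex_isOpen
  refine ⟨pderiv_contDiffOn hU hf.1 i, fun x hx t ht => ?_⟩
  have hdiff : ∀ y ∈ belowApex, HasFDerivAt f (fderiv ℝ f y) y := fun y hy =>
    ((hf.1.contDiffAt (hU.mem_nhds hy)).differentiableAt (by simp)).hasFDerivAt
  have hmem : apex + t • (x - apex) ∈ belowApex := by
    rw [apex_add_smul_sub_apex]
    exact sub_lt_self 1 (mul_pos ht (sub_pos.2 hx))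
  have hhom : HasFDerivAt (fun y : R3 => apex + t • (y - apex)) (t • .id ℝ R3) x :=
    (((hasFDerivAt_id x).sub_const apex).const_smul t).const_add apex
  have hscaled : (fun y => f (apex + t • (y - apex))) =ᶠ[𝓝 x] t ^ (d + 1) • f :=
    Filter.eventually_of_mem (hU.mem_nhds hx) fun y hy => hf.2 y hy t ht
  have huniq := ((hdiff _ hmem).comp x hhom).unique
    (((hdiff x hx).const_smul (t ^ (d + 1))).congr_of_eventuallyEq hscaled)
  have happly := congr($huniq (Pi.single i 1))
  simp only [ContinuousLinearMap.comp_apply, smul_apply, ContinuousLinearMap.id_apply, map_smul,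
    smul_eq_mul] at happly
  refine mul_left_cancel₀ ht.ne' (happly.trans ?_)
  rw [pderiv]
  ring

lemma iterate_pderiv_mem_conicHom (i : Fin 3) (n : ℕ) (hf : f ∈ conicHom (d + n)) :
    (pderiv i)^[n] f ∈ conicHom d := by
  induction n generalizing f with
  | zero => exact hf
  | succ n ih => exact ih (pderiv_mem_conicHom hf i)

lemma multiDeriv_mem_conicHom {α : Fin 3 → ℕ} (hf : f ∈ conicHom (d + ∑ i, α i)) :
    multiDeriv α f ∈ conicHom d := by
  rw [Fin.sum_univ_three, ← add_assoc, ← add_assoc] at hf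
  exact iterate_pderiv_mem_conicHom 0 _
    (iterate_pderiv_mem_conicHom 1 _ (iterate_pderiv_mem_conicHom 2 _ hf))

/- The values on the pyramid are scaled values on its base, which is a compact set below the
apex. -/
lemma exists_abs_le_of_mem_conicHom (hf : f ∈ conicHom d) :
    ∃ B, ∀ x ∈ refPyramid, |f x| ≤ B := by
  have hbase : Set.Icc 0 ![1, 1, 0] ⊆ belowApex := fun y hy => (hy.2 2).trans_lt zero_lt_one
  obtain ⟨B, hB⟩ := isCompact_Icc.exists_bound_of_continuousOn (hf.1.continuousOn.mono hbase)
  refine ⟨B, fun x hx => ?_⟩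
  have hpos := one_sub_pos_of_mem_refPyramid hx
  set y : R3 := ![x 0 / (1 - x 2), x 1 / (1 - x 2), 0] with hy
  have hymem : y ∈ Set.Icc 0 ![1, 1, 0] := by
    obtain ⟨-, h2, h3, h4, h5⟩ := hx
    constructor <;> intro i <;> fin_cases i
    · exact div_nonneg h2.le hpos.le
    · exact div_nonneg h4.le hpos.le
    · exact le_rfl
    · exact (div_le_one hpos).2 h3.le
    · exact (div_le_one hpos).2 h5.le
    · exact le_rfl
  have hxy : x = apex + (1 - x 2) • (y - apex) := by
    rw [apex_add_smul_sub_apex]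
    ext i
    fin_cases i <;> simp [hy, mul_div_cancel₀, hpos.ne']
  rw [hxy, hf.2 y (hbase hymem) _ hpos, abs_mul, abs_of_nonneg (by positivity)]
  exact (mul_le_of_le_one_left (abs_nonneg _)
    (pow_le_one₀ hpos.le (by linarith [hx.1]))).trans (hB y hymem)

lemma eq_zero_of_fderiv_eq_zero_of_mem_conicHom (hd : d ≠ 0) (hf : f ∈ conicHom d)
    (h : ∀ x ∈ refPyramid, fderiv ℝ f x = 0) : ∀ x ∈ refPyramid, f x = 0 := by
  intro x hx
  have hmid : apex + (1 / 2 : ℝ) • (x - apex) ∈ refPyramid := by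
    obtain ⟨h1, h2, h3, h4, h5⟩ := hx
    rw [apex_add_smul_sub_apex]
    simp only [refPyramid, Set.mem_ofPred_eq, Matrix.cons_val]
    refine ⟨?_, ?_, ?_, ?_, ?_⟩ <;> linarith
  have hconst := refPyramid_isOpen.is_const_of_fderiv_eq_zero refPyramid_convex.isPreconnected
    ((contDiffOn_of_mem_conicHom hf).differentiableOn (by simp)) h hx hmid
  rw [hf.2 x (refPyramid_subset_belowApex hx) _ (by norm_num)] at hconst
  have hlt : (1 / 2 : ℝ) ^ d < 1 := pow_lt_one₀ (by norm_num) (by norm_num) hd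
  have hmul : (1 - (1 / 2 : ℝ) ^ d) * f x = 0 := by linarith
  exact (mul_eq_zero.1 hmul).resolve_left (by linarith)

lemma eq_zero_of_multiDeriv_eq_zero_of_mem_conicHom (hf : f ∈ conicHom d)
    (h : ∀ α : Fin 3 → ℕ, ∑ i, α i = d → ∀ x ∈ refPyramid, multiDeriv α f x = 0) :
    ∀ x ∈ refPyramid, f x = 0 := by
  have hU := refPyramid_isOpen
  induction d generalizing f with
  | zero => exact h 0 (by simp)
  | succ d ih =>
    have hfs := contDiffOn_of_mem_conicHom hf
    have hpderiv (i : Fin 3) : ∀ x ∈ refPyramid, pderiv i f x = 0 := by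
      refine ih (pderiv_mem_conicHom hf i) fun α hα x hx => ?_
      rw [← multiDeriv_pderiv_comm hU hfs α i hx, pderiv_multiDeriv hU hfs α i hx]
      exact h _ (by simp [Finset.sum_add_distrib, hα]) x hx
    refine eq_zero_of_fderiv_eq_zero_of_mem_conicHom d.succ_ne_zero hf fun x hx => ?_
    refine ContinuousLinearMap.coe_injective ((Pi.basisFun ℝ (Fin 3)).ext fun i => ?_)
    rw [Pi.basisFun_apply]
    exact hpderiv i x hx

end ConicHom

/-! ### Seminorms on finite-dimensional spaces -/

lemma exists_norm_le_of_ker_le {E F G : Type*} [AddCommGroup E] [Module ℝ E]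
    [FiniteDimensional ℝ E] [NormedAddCommGroup F] [NormedSpace ℝ F] [SeminormedAddCommGroup G]
    [NormedSpace ℝ G] (T : E →ₗ[ℝ] F) (S : E →ₗ[ℝ] G) (h : T.ker ≤ S.ker) :
    ∃ C, 0 ≤ C ∧ ∀ e, ‖S e‖ ≤ C * ‖T e‖ := by
  obtain ⟨g, hg⟩ := T.rangeRestrict.exists_rightInverse_of_surjective T.range_rangeRestrict
  let L : T.range →L[ℝ] G := LinearMap.toContinuousLinearMap (S ∘ₗ g)
  refine ⟨‖L‖, L.opNorm_nonneg, fun e => ?_⟩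
  have hker : e - g (T.rangeRestrict e) ∈ T.ker := by
    have := congr(($hg (T.rangeRestrict e) : F))
    simpa [sub_eq_zero] using this.symm
  have hL : L (T.rangeRestrict e) = S e := by
    have := h hker
    rw [LinearMap.mem_ker, map_sub, sub_eq_zero] at this
    exact this.symm
  rw [← hL]
  exact L.le_opNorm _

section Seminorm

variable {U : Set R3} {V : Submodule ℝ (R3 → ℝ)} {m : ℕ}

lemma hSeminorm_congr {f g : R3 → ℝ} (hU : IsOpen U) (h : Set.EqOn f g U) :
    hSeminorm m f U = hSeminorm m g U := by
  unfold hSeminorm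
  congr 2
  refine Finset.sum_congr rfl fun α _ => ?_
  rw [eLpNorm_congr_ae (ae_restrict_of_forall_mem hU.measurableSet (multiDeriv_congr hU h α))]

/-- The partial derivatives of order `m` of the functions in `V`, as elements of `L²(U)`. -/
noncomputable def multiDerivLp (hU : IsOpen U) (hV : ∀ f ∈ V, ContDiffOn ℝ ∞ f U)
    (hL : ∀ f ∈ V, ∀ α ∈ multiIdx m, MemLp (multiDeriv α f) 2 (volume.restrict U)) :
    V →ₗ[ℝ] multiIdx m → Lp ℝ 2 (volume.restrict U) where
  toFun f α := (hL f f.2 α α.2).toLp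
  map_add' f g := by
    ext1 α
    rw [Pi.add_apply, ← MemLp.toLp_add, MemLp.toLp_eq_toLp_iff]
    exact ae_restrict_of_forall_mem hU.measurableSet (multiDeriv_add hU (hV f f.2) (hV g g.2) α)
  map_smul' c f := by
    ext1 α
    rw [Pi.smul_apply, RingHom.id_apply, ← MemLp.toLp_const_smul, MemLp.toLp_eq_toLp_iff]
    exact ae_restrict_of_forall_mem hU.measurableSet (multiDeriv_smul hU (hV f f.2) c α)

lemma norm_multiDerivLp_le (hU : IsOpen U) (hV : ∀ f ∈ V, ContDiffOn ℝ ∞ f U)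
    (hL : ∀ f ∈ V, ∀ α ∈ multiIdx m, MemLp (multiDeriv α f) 2 (volume.restrict U)) (f : V) :
    ‖multiDerivLp hU hV hL f‖ ≤ hSeminorm m f U := by
  refine (pi_norm_le_iff_of_nonneg (Real.sqrt_nonneg _)).2 fun α => Real.le_sqrt_of_sq_le ?_
  have hnorm : ‖multiDerivLp hU hV hL f α‖ =
      (eLpNorm (multiDeriv α f) 2 (volume.restrict U)).toReal := Lp.norm_toLp _ (hL f f.2 α α.2)
  rw [hnorm, ← ENNReal.toReal_pow]
  refine ENNReal.toReal_mono (ENNReal.sum_ne_top.2 fun β hβ =>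
    ENNReal.pow_ne_top (hL f f.2 β hβ).2.ne) ?_
  exact Finset.single_le_sum (f := fun α => eLpNorm (multiDeriv α f) 2 (volume.restrict U) ^ 2)
    (fun _ _ => zero_le) α.2

lemma multiDeriv_eq_zero_of_multiDerivLp_eq_zero {hU : IsOpen U}
    {hV : ∀ f ∈ V, ContDiffOn ℝ ∞ f U}
    {hL : ∀ f ∈ V, ∀ α ∈ multiIdx m, MemLp (multiDeriv α f) 2 (volume.restrict U)} {f : V}
    (hf : multiDerivLp hU hV hL f = 0) {α : Fin 3 → ℕ} (hα : α ∈ multiIdx m) :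
    ∀ x ∈ U, multiDeriv α f x = 0 := by
  have hzero : (hL f f.2 α hα).toLp = 0 := congrFun hf ⟨α, hα⟩
  have hae : multiDeriv α f =ᵐ[volume.restrict U] 0 :=
    (hL f f.2 α hα).coeFn_toLp.symm.trans (Lp.eq_zero_iff_ae_eq_zero.1 hzero)
  exact Measure.eqOn_open_of_ae_eq hae hU
    (multiDeriv_contDiffOn hU (hV f f.2) α).continuousOn continuousOn_const

theorem exists_abs_le_mul_hSeminorm [FiniteDimensional ℝ V] (hU : IsOpen U)
    (hV : ∀ f ∈ V, ContDiffOn ℝ ∞ f U) (hB : ∀ f ∈ V, ∃ B, ∀ x ∈ U, |f x| ≤ B)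
    (hL : ∀ f ∈ V, ∀ α ∈ multiIdx m, MemLp (multiDeriv α f) 2 (volume.restrict U))
    (hker : ∀ f ∈ V, (∀ α ∈ multiIdx m, ∀ x ∈ U, multiDeriv α f x = 0) → ∀ x ∈ U, f x = 0) :
    ∃ C, 0 ≤ C ∧ ∀ f ∈ V, ∀ x ∈ U, |f x| ≤ C * hSeminorm m f U := by
  choose B hB using hB
  let S : V →ₗ[ℝ] BoundedContinuousFunction U ℝ :=
    { toFun := fun f => .ofNormedAddCommGroup (fun x : U => f.1 x)
        (hV f f.2).continuousOn.domRestrict (B f f.2) fun x => hB f f.2 x x.2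
      map_add' := fun f g => rfl
      map_smul' := fun c f => rfl }
  have hle : (multiDerivLp hU hV hL).ker ≤ S.ker := fun f hf => by
    ext x
    exact hker f f.2 (fun α hα => multiDeriv_eq_zero_of_multiDerivLp_eq_zero hf hα) x x.2
  obtain ⟨C, hC, hSC⟩ := exists_norm_le_of_ker_le _ S hle
  refine ⟨C, hC, fun f hf x hx => ?_⟩
  calc |f x| ≤ ‖S ⟨f, hf⟩‖ := (S ⟨f, hf⟩).norm_coe_le_norm ⟨x, hx⟩
    _ ≤ C * ‖multiDerivLp hU hV hL ⟨f, hf⟩‖ := hSC _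
    _ ≤ C * hSeminorm m f U := by
      gcongr
      exact norm_multiDerivLp_le hU hV hL ⟨f, hf⟩

end Seminorm

/-! ### The error estimate on the reference pyramid -/

/-- The function `x^a y^b (1+z)^{-d}` of the infinite pyramid coordinates, in reference
coordinates. -/
noncomputable def conicMono (a b d : ℕ) (x : R3) : ℝ :=
  (x 0 / (1 - x 2)) ^ a * (x 1 / (1 - x 2)) ^ b * (1 - x 2) ^ d

lemma conicMono_mem_conicHom (a b d : ℕ) : conicMono a b d ∈ conicHom d := by
  constructor
  · have hpos : ∀ x ∈ belowApex, 1 - x 2 ≠ 0 := fun x hx => (sub_pos.2 hx).ne'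
    unfold conicMono
    fun_prop (disch := assumption)
  · intro x _ t ht
    simp only [conicMono, apex_add_smul_sub_apex, Matrix.cons_val, sub_sub_cancel,
      mul_div_mul_left _ _ ht.ne', mul_pow]
    ring

lemma conicMono_duffy (a b d : ℕ) {p : R3} (hp : p ∈ cube) :
    conicMono a b d (duffy p) = p 0 ^ a * p 1 ^ b * (1 - p 2) ^ d := by
  have h : 1 - p 2 ≠ 0 := (sub_pos.2 (mem_cube.1 hp 2).2).ne'
  simp only [conicMono, duffy, Matrix.cons_val, mul_div_cancel_right₀ _ h]

/-- The span of the conical monomials of degrees at most `n` in `x` and in `y` whose degrees of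
homogeneity about the apex belong to `D`. The reference components of the shape functions of
order `k` lie in `conicSpan k (Finset.Iic k)`, those of the exactly `r`-weighted fields in
`conicSpan (r + 1) {r}`. -/
def conicSpan (n : ℕ) (D : Finset ℕ) : Submodule ℝ (R3 → ℝ) :=
  Submodule.span ℝ {f | ∃ a b d : ℕ, a ≤ n ∧ b ≤ n ∧ d ∈ D ∧ f = conicMono a b d}

instance finiteDimensional_conicSpan (n : ℕ) (D : Finset ℕ) :
    FiniteDimensional ℝ (conicSpan n D) := by
  refine FiniteDimensional.span_of_finite ℝ (Set.Finite.subset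
    ((Finset.Iic n ×ˢ Finset.Iic n ×ˢ D).finite_toSet.image
      fun t => conicMono t.1 t.2.1 t.2.2) ?_)
  rintro _ ⟨a, b, d, ha, hb, hd, rfl⟩
  exact ⟨(a, b, d), by simp [ha, hb, hd], rfl⟩

section ConicSpan

variable {n : ℕ} {D : Finset ℕ} {f : R3 → ℝ}

lemma contDiffOn_of_mem_conicSpan (hf : f ∈ conicSpan n D) : ContDiffOn ℝ ∞ f refPyramid := by
  refine Submodule.span_induction (p := fun f _ => ContDiffOn ℝ ∞ f refPyramid) ?_
    contDiffOn_const (fun _ _ _ _ hf hg => hf.add hg) (fun _ _ _ hf => contDiffOn_const.smul hf) hf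
  rintro _ ⟨a, b, d, -, -, -, rfl⟩
  exact contDiffOn_of_mem_conicHom (conicMono_mem_conicHom a b d)

lemma exists_abs_le_of_mem_conicSpan (hf : f ∈ conicSpan n D) :
    ∃ B, ∀ x ∈ refPyramid, |f x| ≤ B := by
  refine Submodule.span_induction (p := fun f _ => ∃ B, ∀ x ∈ refPyramid, |f x| ≤ B) ?_
    ⟨0, by simp⟩ ?_ ?_ hf
  · rintro _ ⟨a, b, d, -, -, -, rfl⟩
    exact exists_abs_le_of_mem_conicHom (conicMono_mem_conicHom a b d)
  · rintro f g _ _ ⟨B, hB⟩ ⟨B', hB'⟩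
    exact ⟨B + B', fun x hx => (abs_add_le _ _).trans (add_le_add (hB x hx) (hB' x hx))⟩
  · rintro c f _ ⟨B, hB⟩
    refine ⟨|c| * B, fun x hx => ?_⟩
    rw [Pi.smul_apply, smul_eq_mul, abs_mul]
    exact mul_le_mul_of_nonneg_left (hB x hx) (abs_nonneg c)

lemma conicSpan_singleton_le_conicHom (n d : ℕ) : conicSpan n {d} ≤ conicHom d := by
  refine Submodule.span_le.2 ?_
  rintro _ ⟨a, b, d', -, -, hd, rfl⟩
  rw [Finset.mem_singleton.1 hd]
  exact conicMono_mem_conicHom a b d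

lemma memLp_refPyramid {p : ENNReal} {B : ℝ} (hf : ContinuousOn f refPyramid)
    (hB : ∀ x ∈ refPyramid, |f x| ≤ B) : MemLp f p (volume.restrict refPyramid) := by
  have : IsFiniteMeasure (volume.restrict refPyramid) :=
    isFiniteMeasure_restrict.2 volume_refPyramid_lt_top.ne
  have hmeas := refPyramid_isOpen.measurableSet
  exact .of_bound (hf.aestronglyMeasurable hmeas) B (ae_restrict_of_forall_mem hmeas hB)

lemma exists_abs_le_mul_hSeminorm_zero_of_mem_conicSpan (n : ℕ) (D : Finset ℕ) :
    ∃ C, 0 ≤ C ∧ ∀ f ∈ conicSpan n D, ∀ x ∈ refPyramid,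
      |f x| ≤ C * hSeminorm 0 f refPyramid := by
  refine exists_abs_le_mul_hSeminorm refPyramid_isOpen (fun _ => contDiffOn_of_mem_conicSpan)
    (fun _ => exists_abs_le_of_mem_conicSpan) (fun f hf α hα => ?_)
    (fun f _ h => h 0 (mem_multiIdx.2 (by simp)))
  obtain ⟨B, hB⟩ := exists_abs_le_of_mem_conicSpan hf
  obtain rfl : α = 0 := by simpa [mem_multiIdx, funext_iff] using hα
  exact memLp_refPyramid (contDiffOn_of_mem_conicSpan hf).continuousOn hB

lemma exists_abs_le_mul_hSeminorm_of_mem_conicSpan_singleton (n d : ℕ) :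
    ∃ C, 0 ≤ C ∧ ∀ f ∈ conicSpan n {d}, ∀ x ∈ refPyramid,
      |f x| ≤ C * hSeminorm d f refPyramid := by
  have hle := conicSpan_singleton_le_conicHom n d
  refine exists_abs_le_mul_hSeminorm refPyramid_isOpen (fun _ => contDiffOn_of_mem_conicSpan)
    (fun _ => exists_abs_le_of_mem_conicSpan) (fun f hf α hα => ?_) (fun f hf h =>
      eq_zero_of_multiDeriv_eq_zero_of_mem_conicHom (hle hf) fun α hα => h α (mem_multiIdx.2 hα))
  have hderiv : multiDeriv α f ∈ conicHom 0 :=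
    multiDeriv_mem_conicHom (by rw [mem_multiIdx.1 hα, zero_add]; exact hle hf)
  obtain ⟨B, hB⟩ := exists_abs_le_of_mem_conicHom hderiv
  exact memLp_refPyramid (contDiffOn_of_mem_conicHom hderiv).continuousOn hB

end ConicSpan

/-- The integrable functions on the reference pyramid for which the conical product rule is
exact. -/
noncomputable def exactSubmodule (k : ℕ) : Submodule ℝ (R3 → ℝ) where
  carrier := {f | IntegrableOn f refPyramid volume ∧ errRef k f = 0}
  add_mem' := fun hf hg =>
    ⟨hf.1.add hg.1, by rw [errRef_add k hf.1 hg.1, hf.2, hg.2, add_zero]⟩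
  zero_mem' := ⟨integrableOn_zero, by simp [errRef, quadRef]⟩
  smul_mem' := fun c f hf => ⟨hf.1.smul c, by rw [errRef_smul, hf.2, mul_zero]⟩

lemma abs_coord_le_one {x : R3} (hx : x ∈ refPyramid) (i : Fin 3) : |x i| ≤ 1 := by
  obtain ⟨h1, h2, h3, h4, h5⟩ := hx
  rw [abs_le]
  fin_cases i <;> constructor <;> simp <;> linarith

lemma monomial_mul_conicMono_mul_conicMono_mem_exactSubmodule {k a b d a' b' d' : ℕ}
    {c : Fin 3 → ℕ} (ha : c 0 + a + a' ≤ 2 * k + 1) (hb : c 1 + b + b' ≤ 2 * k + 1)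
    (hd : ∑ i, c i + d + d' ≤ 2 * k + 1) :
    (fun x => ∏ i, x i ^ c i) * conicMono a b d * conicMono a' b' d' ∈ exactSubmodule k := by
  constructor
  · obtain ⟨B, hB⟩ := exists_abs_le_of_mem_conicHom (conicMono_mem_conicHom a b d)
    obtain ⟨B', hB'⟩ := exists_abs_le_of_mem_conicHom (conicMono_mem_conicHom a' b' d')
    have hcont (a b d : ℕ) : ContinuousOn (conicMono a b d) refPyramid :=
      (contDiffOn_of_mem_conicHom (conicMono_mem_conicHom a b d)).continuousOn
    refine integrableOn_refPyramid (B := 1 * B * B')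
      ((ContinuousOn.mul (by fun_prop) (hcont a b d)).mul (hcont a' b' d')) fun x hx => ?_
    have hmono : |∏ i, x i ^ c i| ≤ 1 := by
      rw [Finset.abs_prod]
      refine Finset.prod_le_one (fun i _ => abs_nonneg _) fun i _ => ?_
      rw [abs_pow]
      exact pow_le_one₀ (abs_nonneg _) (abs_coord_le_one hx i)
    have hB0 : 0 ≤ B := (abs_nonneg _).trans (hB x hx)
    simp only [Pi.mul_apply, abs_mul]
    gcongr
    exacts [hB x hx, hB' x hx]
  · rw [Fin.sum_univ_three] at hd
    have hdeg : (1 - Polynomial.X : ℝ[X]).natDegree ≤ 1 := by compute_degree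
    refine errRef_eq_zero_of_comp_duffy_eq_prod k
      (P := ![Polynomial.X ^ (c 0 + a + a'), Polynomial.X ^ (c 1 + b + b'),
        (1 - Polynomial.X) ^ (c 0 + c 1 + d + d') * Polynomial.X ^ c 2]) ?_ fun p hp => ?_
    · intro i
      fin_cases i
      · simpa using ha
      · simpa using hb
      · refine (Polynomial.natDegree_mul_le_of_le (Polynomial.natDegree_pow_le_of_le _ hdeg)
          (Polynomial.natDegree_X_pow_le _)).trans (by omega)
    · simp only [Pi.mul_apply, conicMono_duffy _ _ _ hp, Fin.prod_univ_three]
      simp only [duffy, Matrix.cons_val, Polynomial.eval_mul, Polynomial.eval_pow,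
        Polynomial.eval_X, Polynomial.eval_sub, Polynomial.eval_one, mul_pow]
      ring

lemma eval_mem_span_monomials {m : ℕ} {p : MvPolynomial (Fin 3) ℝ} (hp : p.totalDegree ≤ m) :
    (fun x => MvPolynomial.eval x p) ∈ Submodule.span ℝ
      {f : R3 → ℝ | ∃ c : Fin 3 → ℕ, ∑ i, c i ≤ m ∧ f = fun x => ∏ i, x i ^ c i} := by
  have heval : (fun x => MvPolynomial.eval x p) =
      ∑ c ∈ p.support, p.coeff c • fun x : R3 => ∏ i, x i ^ c i := by
    ext x
    simp [MvPolynomial.eval_eq']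
  rw [heval]
  refine Submodule.sum_mem _ fun c hc => Submodule.smul_mem _ _ (Submodule.subset_span ⟨c, ?_, rfl⟩)
  have := (MvPolynomial.le_totalDegree hc).trans hp
  rwa [Finsupp.sum_fintype _ _ fun _ => rfl] at this

lemma eval_mul_mul_mem_exactSubmodule {k m n n' : ℕ} {D D' : Finset ℕ}
    {p : MvPolynomial (Fin 3) ℝ} {v w : R3 → ℝ} (hn : m + n + n' ≤ 2 * k + 1)
    (hD : ∀ d ∈ D, ∀ d' ∈ D', m + d + d' ≤ 2 * k + 1) (hp : p.totalDegree ≤ m)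
    (hv : v ∈ conicSpan n D) (hw : w ∈ conicSpan n' D') :
    (fun x => MvPolynomial.eval x p) * v * w ∈ exactSubmodule k := by
  have hmem := Submodule.mul_mem_mul (Submodule.mul_mem_mul (eval_mem_span_monomials hp) hv) hw
  rw [conicSpan, conicSpan, Submodule.span_mul_span, Submodule.span_mul_span] at hmem
  refine Submodule.span_le.2 ?_ hmem
  rintro _ ⟨_, ⟨_, ⟨c, hc, rfl⟩, _, ⟨a, b, d, ha, hb, hd, rfl⟩, rfl⟩, _,
    ⟨a', b', d', ha', hb', hd', rfl⟩, rfl⟩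
  have hci (i : Fin 3) : c i ≤ m := (Finset.single_le_sum (by simp) (Finset.mem_univ i)).trans hc
  have := hci 0
  have := hci 1
  have := hD d hd d' hd'
  exact monomial_mul_conicMono_mul_conicMono_mem_exactSubmodule
    (by omega) (by omega) (by omega)

lemma MemWInf.exists_abs_le {m : ℕ} {U : Set R3} (hU : IsOpen U) {f : R3 → ℝ}
    (hf : MemWInf m f U) (hc : ContinuousOn f U) : ∃ B, ∀ x ∈ U, |f x| ≤ B := by
  set B := (eLpNorm f ⊤ (volume.restrict U)).toReal
  refine ⟨B, fun x hx => ?_⟩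
  have hmax : (fun x => max |f x| B) =ᵐ[volume.restrict U] fun _ => B := by
    filter_upwards [ae_le_eLpNormEssSup (f := f) (μ := volume.restrict U)] with y hy
    rw [← eLpNorm_exponent_top] at hy
    rw [max_eq_right_iff, ← Real.norm_eq_abs, ← toReal_enorm]
    exact ENNReal.toReal_mono (hf.memLp hU).2.ne hy
  exact max_eq_right_iff.1 (Measure.eqOn_open_of_ae_eq hmax hU (hc.abs.sup continuousOn_const)
    continuousOn_const hx)

lemma abs_mul_mul_le {a b c A B C : ℝ} (ha : |a| ≤ A) (hb : |b| ≤ B) (hc : |c| ≤ C) :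
    |a * b * c| ≤ A * B * C := by
  rw [abs_mul, abs_mul]
  have hA := (abs_nonneg a).trans ha
  have hB := (abs_nonneg b).trans hb
  gcongr

lemma exists_abs_errRef_mul_le_of_contDiff (k : ℕ) :
    ∃ C, 0 ≤ C ∧ ∀ {r : ℕ} {v w g : R3 → ℝ} {Bv Bw M : ℝ}, r ≤ k →
      v ∈ conicSpan (r + 1) {r} → w ∈ conicSpan k (Finset.Iic k) →
      (∀ x ∈ refPyramid, |v x| ≤ Bv) → (∀ x ∈ refPyramid, |w x| ≤ Bw) → ContDiff ℝ ∞ g →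
      (∀ α : Fin 3 → ℕ, ∑ i, α i = k - r + 1 → ∀ x ∈ refPyramid, |multiDeriv α g x| ≤ M) →
      |errRef k (g * v * w)| ≤ C * (3 ^ (k - r + 1) * M * Bv * Bw) := by
  obtain ⟨C, hC, hbound⟩ := exists_abs_errRef_le k
  refine ⟨C, hC, fun {r v w g Bv Bw M} hr hv hw hBv hBw hg hM => ?_⟩
  obtain ⟨p, hp, hgp⟩ := exists_mvPolynomial_abs_sub_eval_le refPyramid_convex refPoint_mem
    (fun x hx => norm_sub_refPoint_le hx) hg hM
  rw [mul_one] at hgp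
  set q : R3 → ℝ := fun x => MvPolynomial.eval x p
  obtain ⟨h_int, hexact⟩ : q * v * w ∈ exactSubmodule k :=
    eval_mul_mul_mem_exactSubmodule (by omega)
      (by simp only [Finset.mem_singleton, Finset.mem_Iic]; omega) hp hv hw
  have hle : ∀ x ∈ refPyramid, |((g - q) * v * w) x| ≤ 3 ^ (k - r + 1) * M * Bv * Bw :=
    fun x hx => abs_mul_mul_le (hgp x hx) (hBv x hx) (hBw x hx)
  have hcont : ContinuousOn ((g - q) * v * w) refPyramid :=
    ((hg.continuous.sub (MvPolynomial.continuous_eval p)).continuousOn.mul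
      (contDiffOn_of_mem_conicSpan hv).continuousOn).mul
      (contDiffOn_of_mem_conicSpan hw).continuousOn
  have hsplit : g * v * w = (g - q) * v * w + q * v * w := by ring
  rw [hsplit, errRef_add k (integrableOn_refPyramid hcont hle) h_int, hexact, add_zero]
  exact hbound _ _ hle

/-- Mollification reduces the estimate to smooth coefficients. -/
theorem exists_abs_errRef_mul_mul_le {k r : ℕ} (hr : r ≤ k) : ∃ C, 0 ≤ C ∧ ∀ a v w : R3 → ℝ,
    MemWInf (k - r + 1) a refPyramid → ContinuousOn a refPyramid →
    v ∈ conicSpan (r + 1) {r} → w ∈ conicSpan k (Finset.Iic k) →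
    |errRef k (a * v * w)| ≤ C * wInfSeminorm (k - r + 1) a refPyramid *
      hSeminorm r v refPyramid * hSeminorm 0 w refPyramid := by
  obtain ⟨C, hC, hsmooth⟩ := exists_abs_errRef_mul_le_of_contDiff k
  obtain ⟨C₁, hC₁, hv_le⟩ := exists_abs_le_mul_hSeminorm_of_mem_conicSpan_singleton (r + 1) r
  obtain ⟨C₂, hC₂, hw_le⟩ :=
    exists_abs_le_mul_hSeminorm_zero_of_mem_conicSpan k (Finset.Iic k)
  refine ⟨C * 3 ^ (k - r + 1) * C₁ * C₂, by positivity, fun a v w ha hac hv hw => ?_⟩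
  obtain ⟨B, hB⟩ := ha.exists_abs_le refPyramid_isOpen hac
  obtain ⟨G, hG, hGB, hGM, hGlim⟩ := exists_smooth_approx refPyramid_isOpen refPyramid_convex
    volume_refPyramid_lt_top.ne ⟨_, refPoint_mem⟩ hac hB
    (fun α hα => (ha.hasWeakDeriv_weakDeriv refPyramid_isOpen hα.le).1)
    (fun α hα => ha.ae_abs_weakDeriv_le refPyramid_isOpen le_rfl hα)
  have hlim : Tendsto (fun j => errRef k (G j * v * w)) atTop (𝓝 (errRef k (a * v * w))) :=
    tendsto_errRef k
      (fun j => ((hG j).continuous.continuousOn.mul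
        (contDiffOn_of_mem_conicSpan hv).continuousOn).mul
        (contDiffOn_of_mem_conicSpan hw).continuousOn)
      (fun j x hx => abs_mul_mul_le (hGB j x hx) (hv_le v hv x hx) (hw_le w hw x hx))
      (fun x hx => ((hGlim x hx).mul_const _).mul_const _)
  refine le_of_tendsto hlim.abs (Eventually.of_forall fun j => ?_)
  refine (hsmooth hr hv hw (hv_le v hv) (hw_le w hw) (hG j) (hGM j)).trans_eq ?_
  ring

/-! ### Shape functions in reference coordinates -/

lemma infPyramid_isOpen : IsOpen infPyramid := by
  simp only [infPyramid]
  refine IsOpen.and ?_ (IsOpen.and ?_ (IsOpen.and ?_ (IsOpen.and ?_ ?_))) <;>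
    exact isOpen_lt (by fun_prop) (by fun_prop)

lemma one_add_pos_of_mem_infPyramid {p : R3} (hp : p ∈ infPyramid) : 0 < 1 + p 2 :=
  add_pos zero_lt_one hp.2.2.2.2

lemma surjOn_projMap : SurjOn projMap infPyramid refPyramid := by
  intro x hx
  have h := one_sub_pos_of_mem_refPyramid hx
  obtain ⟨h1, h2, h3, h4, h5⟩ := hx
  refine ⟨![x 0 / (1 - x 2), x 1 / (1 - x 2), x 2 / (1 - x 2)],
    ⟨div_pos h2 h, (div_lt_one h).2 h3, div_pos h4 h, (div_lt_one h).2 h5, div_pos h1 h⟩, ?_⟩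
  have h_add : 1 + x 2 / (1 - x 2) = (1 - x 2)⁻¹ := by field_simp; ring
  ext i
  fin_cases i <;> simp [projMap, h_add, h.ne']

/-- The functions on the infinite pyramid that are pulled back from `S` by the projective map,
with arbitrary values outside of the infinite pyramid. -/
noncomputable def projPullback (S : Submodule ℝ (R3 → ℝ)) : Submodule ℝ (R3 → ℝ) :=
  (S.map (LinearMap.funLeft ℝ ℝ fun p : infPyramid => projMap p)).comap
    (LinearMap.funLeft ℝ ℝ fun p : infPyramid => (p : R3))

section ProjPullback

variable {S : Submodule ℝ (R3 → ℝ)} {F G f : R3 → ℝ}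

lemma mem_projPullback :
    F ∈ projPullback S ↔ ∃ h ∈ S, EqOn (h ∘ projMap) F infPyramid := by
  simp [projPullback, funext_iff, LinearMap.funLeft, EqOn]

lemma mem_projPullback_congr (h : EqOn F G infPyramid) :
    F ∈ projPullback S ↔ G ∈ projPullback S := by
  have h' : LinearMap.funLeft ℝ ℝ (fun p : infPyramid => (p : R3)) F =
      LinearMap.funLeft ℝ ℝ (fun p : infPyramid => (p : R3)) G := funext fun p => h p.2
  simp only [projPullback, Submodule.mem_comap, h']

lemma exists_eqOn_of_comp_projMap_mem (hf : f ∘ projMap ∈ projPullback S) :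
    ∃ h ∈ S, EqOn f h refPyramid := by
  obtain ⟨h, hS, heq⟩ := mem_projPullback.1 hf
  refine ⟨h, hS, fun x hx => ?_⟩
  obtain ⟨p, hp, rfl⟩ := surjOn_projMap hx
  exact (heq hp).symm

end ProjPullback

/-- The Laurent monomial `x^i y^j (1+z)^l` on the infinite pyramid. -/
noncomputable def infMono (i j l : ℤ) (p : R3) : ℝ := p 0 ^ i * p 1 ^ j * (1 + p 2) ^ l

lemma infMono_mul_infMono {p : R3} (hp : p ∈ infPyramid) (i j l i' j' l' : ℤ) :
    infMono i j l p * infMono i' j' l' p = infMono (i + i') (j + j') (l + l') p := by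
  simp only [infMono, zpow_add₀ hp.1.ne', zpow_add₀ hp.2.2.1.ne',
    zpow_add₀ (one_add_pos_of_mem_infPyramid hp).ne']
  ring

lemma infMono_mem_projPullback_conicSpan {n : ℕ} {D : Finset ℕ} {a b d : ℕ} (ha : a ≤ n)
    (hb : b ≤ n) (hd : d ∈ D) : infMono a b (-d) ∈ projPullback (conicSpan n D) := by
  refine mem_projPullback.2
    ⟨conicMono a b d, Submodule.subset_span ⟨a, b, d, ha, hb, hd, rfl⟩, fun p hp => ?_⟩
  have h := (one_add_pos_of_mem_infPyramid hp).ne'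
  have h_sub : 1 - p 2 / (1 + p 2) = (1 + p 2)⁻¹ := by field_simp; ring
  simp [conicMono, projMap, infMono, h_sub, h]

lemma hasFDerivAt_one_add_coord (p : R3) :
    HasFDerivAt (fun x : R3 => 1 + x 2) (ContinuousLinearMap.proj 2 : R3 →L[ℝ] ℝ) p :=
  (hasFDerivAt_apply 2 p).const_add 1

lemma hasFDerivAt_infMono {p : R3} (hp : p ∈ infPyramid) (i j l : ℤ) :
    HasFDerivAt (infMono i j l) (infMono i j l p •
      ((i / p 0) • (ContinuousLinearMap.proj 0 : R3 →L[ℝ] ℝ) +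
        (j / p 1) • (ContinuousLinearMap.proj 1 : R3 →L[ℝ] ℝ) +
        (l / (1 + p 2)) • (ContinuousLinearMap.proj 2 : R3 →L[ℝ] ℝ))) p := by
  have hx := hp.1.ne'
  have hy := hp.2.2.1.ne'
  have hz := (one_add_pos_of_mem_infPyramid hp).ne'
  refine ((((hasDerivAt_zpow i _ (.inl hx)).comp_hasFDerivAt p (hasFDerivAt_apply 0 p)).mul
    ((hasDerivAt_zpow j _ (.inl hy)).comp_hasFDerivAt p (hasFDerivAt_apply 1 p))).mul
    ((hasDerivAt_zpow l _ (.inl hz)).comp_hasFDerivAt p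
      (hasFDerivAt_one_add_coord p))).congr_fderiv ?_
  ext v
  simp only [infMono, zpow_sub_one₀ hx, zpow_sub_one₀ hy, zpow_sub_one₀ hz, Pi.mul_apply,
    Function.comp_apply, add_apply, smul_apply, ContinuousLinearMap.proj_apply, smul_eq_mul]
  ring

/-- The first-order operator `α x ∂_x + β y ∂_y + γ (1+z) ∂_z + δ`, of which all Laurent monomials
are eigenfunctions. -/
noncomputable def eulerOp (α β γ δ : ℤ) (q : R3 → ℝ) (p : R3) : ℝ :=
  α * p 0 * grad q p 0 + β * p 1 * grad q p 1 + γ * (1 + p 2) * grad q p 2 + δ * q p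

lemma eulerOp_infMono {p : R3} (hp : p ∈ infPyramid) (α β γ δ i j l : ℤ) :
    eulerOp α β γ δ (infMono i j l) p =
      ((α * i + β * j + γ * l + δ : ℤ) : ℝ) * infMono i j l p := by
  have hx := hp.1.ne'
  have hy := hp.2.2.1.ne'
  have hz := (one_add_pos_of_mem_infPyramid hp).ne'
  have hgrad : grad (infMono i j l) p = infMono i j l p • ![i / p 0, j / p 1, l / (1 + p 2)] := by
    ext i
    fin_cases i <;> simp [grad, (hasFDerivAt_infMono hp _ _ _).fderiv]
  simp only [eulerOp, hgrad, Pi.smul_apply, smul_eq_mul, Matrix.cons_val]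
  push_cast
  field_simp

-- The components of the shape functions are combinations of such products. The eigenvalue of the
-- Euler operator vanishes at the monomials whose image would not be pulled back from `conicSpan`.
lemma infMono_mul_eulerOp_infMono_mem_projPullback {k a b c : ℕ} (i j e α β γ δ : ℤ)
    (h : α * a + β * b + γ * -c + δ ≠ 0 →
      (0 ≤ i + a ∧ i + a ≤ k) ∧ (0 ≤ j + b ∧ j + b ≤ k) ∧ 0 ≤ c - e ∧ c - e ≤ k) :
    infMono i j e * eulerOp α β γ δ (infMono a b (-c)) ∈
      projPullback (conicSpan k (Finset.Iic k)) := by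
  have heq : EqOn (infMono i j e * eulerOp α β γ δ (infMono a b (-c)))
      (((α * a + β * b + γ * -c + δ : ℤ) : ℝ) • infMono (i + a) (j + b) (e + -c))
      infPyramid := fun p hp => by
    simp only [Pi.mul_apply, Pi.smul_apply, smul_eq_mul, eulerOp_infMono hp,
      ← infMono_mul_infMono hp]
    ring
  rw [mem_projPullback_congr heq]
  rcases eq_or_ne (α * a + β * b + γ * -c + δ) 0 with h0 | h0
  · rw [h0, Int.cast_zero, zero_smul]
    exact Submodule.zero_mem _
  · obtain ⟨⟨hia, hia'⟩, ⟨hjb, hjb'⟩, hce, hce'⟩ := h h0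
    have hmem := infMono_mem_projPullback_conicSpan (a := (i + a).toNat) (b := (j + b).toNat)
      (d := (c - e).toNat) (n := k) (D := Finset.Iic k) (by omega) (by omega)
      (Finset.mem_Iic.2 (by omega))
    rw [Int.toNat_of_nonneg hia, Int.toNat_of_nonneg hjb, Int.toNat_of_nonneg hce,
      neg_sub, sub_eq_add_neg] at hmem
    exact Submodule.smul_mem _ _ hmem

lemma infMono_mul_eulerOp_mem_projPullback {k n : ℕ} {l m : ℤ} {q : R3 → ℝ}
    (i j e α β γ δ : ℤ) (hq : q ∈ bracketQ n l m)
    (h : ∀ a b c : ℕ, c ≤ n → a ≤ c + l - n → b ≤ c + m - n →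
      α * a + β * b + γ * -c + δ ≠ 0 →
        (0 ≤ i + a ∧ i + a ≤ k) ∧ (0 ≤ j + b ∧ j + b ≤ k) ∧ 0 ≤ c - e ∧ c - e ≤ k) :
    infMono i j e * eulerOp α β γ δ q ∈ projPullback (conicSpan k (Finset.Iic k)) := by
  suffices hdiff : DifferentiableOn ℝ q infPyramid ∧
      infMono i j e * eulerOp α β γ δ q ∈ projPullback (conicSpan k (Finset.Iic k)) from hdiff.2
  refine Submodule.span_induction (p := fun q _ => DifferentiableOn ℝ q infPyramid ∧
    infMono i j e * eulerOp α β γ δ q ∈ projPullback (conicSpan k (Finset.Iic k)))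
    ?_ ?_ ?_ ?_ hq
  · rintro _ ⟨a, b, c, hc, ha, hb, rfl⟩
    have hmono : (fun p : R3 => p 0 ^ a * p 1 ^ b / (1 + p 2) ^ c) = infMono a b (-c) := by
      ext p
      simp [infMono, div_eq_mul_inv]
    rw [hmono]
    exact ⟨fun p hp => (hasFDerivAt_infMono hp _ _ _).differentiableAt.differentiableWithinAt,
      infMono_mul_eulerOp_infMono_mem_projPullback i j e α β γ δ
        (h a b c hc ha hb)⟩
  · refine ⟨differentiableOn_const 0, ?_⟩
    have hzero : infMono i j e * eulerOp α β γ δ 0 = 0 := by ext p; simp [eulerOp, grad]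
    rw [hzero]
    exact Submodule.zero_mem _
  · rintro f g _ _ ⟨hf, hf'⟩ ⟨hg, hg'⟩
    refine ⟨hf.add hg, (mem_projPullback_congr fun p hp => ?_).2 (Submodule.add_mem _ hf' hg')⟩
    have hnhds := infPyramid_isOpen.mem_nhds hp
    simp only [Pi.mul_apply, Pi.add_apply, eulerOp, grad,
      fderiv_add (hf.differentiableAt hnhds) (hg.differentiableAt hnhds), add_apply]
    ring
  · rintro c f _ ⟨hf, hf'⟩
    refine ⟨hf.const_smul c, (mem_projPullback_congr fun p hp => ?_).2 (Submodule.smul_mem _ c hf')⟩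
    have hnhds := infPyramid_isOpen.mem_nhds hp
    simp only [Pi.mul_apply, Pi.smul_apply, smul_eq_mul, eulerOp, grad,
      fderiv_const_smul (hf.differentiableAt hnhds), smul_apply]
    ring

section Jacobian

variable {p : R3}

lemma hasFDerivAt_projMap_apply (hp : p ∈ infPyramid) (i : Fin 3) :
    HasFDerivAt (fun x => projMap x i) (p i • -((1 + p 2) ^ 2)⁻¹ •
      (ContinuousLinearMap.proj 2 : R3 →L[ℝ] ℝ) +
        (1 + p 2)⁻¹ • (ContinuousLinearMap.proj i : R3 →L[ℝ] ℝ)) p := by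
  have hinv := (hasDerivAt_inv (one_add_pos_of_mem_infPyramid hp).ne').comp_hasFDerivAt p
    (hasFDerivAt_one_add_coord p)
  have hproj : (fun x => projMap x i) = fun x => x i * (1 + x 2)⁻¹ := by
    ext x
    fin_cases i <;> rfl
  rw [hproj]
  exact (hasFDerivAt_apply i p).mul hinv

lemma jacobian_projMap (hp : p ∈ infPyramid) : jacobian projMap p =
    !![1 / (1 + p 2), 0, -p 0 / (1 + p 2) ^ 2;
      0, 1 / (1 + p 2), -p 1 / (1 + p 2) ^ 2;
      0, 0, 1 / (1 + p 2) ^ 2] := by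
  have hz := (one_add_pos_of_mem_infPyramid hp).ne'
  have hproj : HasFDerivAt projMap _ p := hasFDerivAt_pi.2 (hasFDerivAt_projMap_apply hp)
  ext i j
  rw [jacobian, Matrix.of_apply, hproj.fderiv]
  fin_cases i <;> fin_cases j <;> simp <;> field_simp
  ring

lemma det_jacobian_projMap (hp : p ∈ infPyramid) :
    (jacobian projMap p).det = ((1 + p 2) ^ 4)⁻¹ := by
  have hz := (one_add_pos_of_mem_infPyramid hp).ne'
  simp only [jacobian_projMap hp, Matrix.det_fin_three, Matrix.of_apply, Matrix.cons_val]
  field_simp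
  ring

lemma inv_jacobian_projMap (hp : p ∈ infPyramid) : (jacobian projMap p)⁻¹ =
    !![1 + p 2, 0, p 0 * (1 + p 2); 0, 1 + p 2, p 1 * (1 + p 2); 0, 0, (1 + p 2) ^ 2] := by
  have hz := (one_add_pos_of_mem_infPyramid hp).ne'
  rw [jacobian_projMap hp]
  refine Matrix.inv_eq_left_inv ?_
  ext i j
  fin_cases i <;> fin_cases j <;> simp [Matrix.mul_apply, Fin.sum_univ_three, hz] <;>
    field_simp <;> ring

end Jacobian

section ShapeFunctions

variable {k : ℕ}

lemma mulVec_mem_projPullback_of_mem_spaceP_zero {u : Proxy 0} (hu : u ∈ spaceP 0 k) (i : Fin 1) :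
    (fun p => (weight 0 (jacobian projMap p) *ᵥ u p) i) ∈
      projPullback (conicSpan k (Finset.Iic k)) := by
  obtain ⟨q, hq, hu⟩ := hu
  have hq' := infMono_mul_eulerOp_mem_projPullback (k := k) 0 0 0 0 0 0 1 hq (by omega)
  refine (mem_projPullback_congr fun p hp => ?_).2 hq'
  simp [hu p hp, weight, Matrix.mulVec, dotProduct, infMono, eulerOp]

lemma weight_one_jacobian_projMap_mulVec {p : R3} (hp : p ∈ infPyramid) (c : Fin 3 → ℝ) :
    weight 1 (jacobian projMap p) *ᵥ c =
      ![(1 + p 2) * c 0, (1 + p 2) * c 1,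
        p 0 * (1 + p 2) * c 0 + p 1 * (1 + p 2) * c 1 + (1 + p 2) ^ 2 * c 2] := by
  ext i
  fin_cases i <;>
    simp [weight, inv_jacobian_projMap hp, Matrix.mulVec, dotProduct, Fin.sum_univ_three]

lemma weight_two_jacobian_projMap_mulVec {p : R3} (hp : p ∈ infPyramid) (c : Fin 3 → ℝ) :
    weight 2 (jacobian projMap p) *ᵥ c =
      ![(1 + p 2) ^ 3 * c 0 - p 0 * (1 + p 2) ^ 2 * c 2,
        (1 + p 2) ^ 3 * c 1 - p 1 * (1 + p 2) ^ 2 * c 2,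
        (1 + p 2) ^ 2 * c 2] := by
  have hz := (one_add_pos_of_mem_infPyramid hp).ne'
  have hdet : weight 2 (jacobian projMap p) = (1 + p 2) ^ 4 • jacobian projMap p := by
    rw [weight, det_jacobian_projMap hp, inv_inv]
  rw [hdet, jacobian_projMap hp]
  ext i
  fin_cases i <;>
    simp [Matrix.mulVec, dotProduct, Fin.sum_univ_three, -mul_eq_mul_right_iff] <;> field_simp <;>
    ring

lemma mulVec_mem_projPullback_of_mem_spaceP_one {u : Proxy 1} (hu : u ∈ spaceP 1 k) (i : Fin 3) :
    (fun p => (weight 1 (jacobian projMap p) *ᵥ u p) i) ∈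
      projPullback (conicSpan k (Finset.Iic k)) := by
  obtain ⟨q₁, hq₁, q₂, hq₂, q, hq, hu⟩ := hu
  match i with
  | 0 =>
    refine (mem_projPullback_congr fun p hp => ?_).2 (Submodule.add_mem _
      (infMono_mul_eulerOp_mem_projPullback (k := k) 0 0 1 0 0 0 1 hq₁ (by omega))
      (infMono_mul_eulerOp_mem_projPullback (k := k) (-1) 0 1 1 0 0 0 hq (by omega)))
    have hx := hp.1.ne'
    simp only [weight_one_jacobian_projMap_mulVec hp, hu p hp, Pi.add_apply, Pi.mul_apply,
      Matrix.cons_val, infMono, eulerOp, zpow_neg, zpow_ofNat]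
    push_cast
    field_simp
    ring
  | 1 =>
    refine (mem_projPullback_congr fun p hp => ?_).2 (Submodule.add_mem _
      (infMono_mul_eulerOp_mem_projPullback (k := k) 0 0 1 0 0 0 1 hq₂ (by omega))
      (infMono_mul_eulerOp_mem_projPullback (k := k) 0 (-1) 1 0 1 0 0 hq (by omega)))
    have hy := hp.2.2.1.ne'
    simp only [weight_one_jacobian_projMap_mulVec hp, hu p hp, Pi.add_apply, Pi.mul_apply,
      Matrix.cons_val, infMono, eulerOp, zpow_neg, zpow_ofNat]
    push_cast
    field_simp
    ring
  | 2 =>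
    refine (mem_projPullback_congr fun p hp => ?_).2 (Submodule.add_mem _ (Submodule.add_mem _
      (infMono_mul_eulerOp_mem_projPullback (k := k) 1 0 1 0 0 0 1 hq₁ (by omega))
      (infMono_mul_eulerOp_mem_projPullback (k := k) 0 1 1 0 0 0 1 hq₂ (by omega)))
      (infMono_mul_eulerOp_mem_projPullback (k := k) 0 0 1 1 1 1 0 hq (by omega)))
    simp only [weight_one_jacobian_projMap_mulVec hp, hu p hp, Pi.add_apply, Pi.mul_apply,
      Matrix.cons_val, infMono, eulerOp, zpow_ofNat]
    push_cast
    ring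

lemma cons_add_curl_horizontal (q₁ q₂ q₃ : R3 → ℝ) (p : R3) :
    ![0, 0, q₃ p] + curl (fun y => ![q₁ y, q₂ y, 0]) p =
      ![-grad q₂ p 2, grad q₁ p 2, q₃ p + (grad q₂ p 0 - grad q₁ p 1)] := by
  ext i
  fin_cases i <;> simp [curl, grad]

lemma mulVec_mem_projPullback_of_mem_spaceP_two {u : Proxy 2} (hu : u ∈ spaceP 2 k) (i : Fin 3) :
    (fun p => (weight 2 (jacobian projMap p) *ᵥ u p) i) ∈
      projPullback (conicSpan k (Finset.Iic k)) := by
  obtain ⟨q₃, hq₃, q₁, hq₁, q₂, hq₂, hu⟩ := hu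
  match i with
  | 0 =>
    refine (mem_projPullback_congr fun p hp => ?_).2 (Submodule.add_mem _ (Submodule.add_mem _
      (infMono_mul_eulerOp_mem_projPullback (k := k) 1 (-1) 2 0 1 0 0 hq₁ (by omega))
      (infMono_mul_eulerOp_mem_projPullback (k := k) 0 0 2 (-1) 0 (-1) 0 hq₂ (by omega)))
      (infMono_mul_eulerOp_mem_projPullback (k := k) 1 0 2 0 0 0 (-1) hq₃ (by omega)))
    have hy := hp.2.2.1.ne'
    simp only [weight_two_jacobian_projMap_mulVec hp, hu p hp, cons_add_curl_horizontal,
      Pi.add_apply, Pi.mul_apply, Matrix.cons_val, infMono, eulerOp, zpow_neg, zpow_ofNat]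
    push_cast
    field_simp
    ring
  | 1 =>
    refine (mem_projPullback_congr fun p hp => ?_).2 (Submodule.add_mem _ (Submodule.add_mem _
      (infMono_mul_eulerOp_mem_projPullback (k := k) 0 0 2 0 1 1 0 hq₁ (by omega))
      (infMono_mul_eulerOp_mem_projPullback (k := k) (-1) 1 2 (-1) 0 0 0 hq₂ (by omega)))
      (infMono_mul_eulerOp_mem_projPullback (k := k) 0 1 2 0 0 0 (-1) hq₃ (by omega)))
    have hx := hp.1.ne'
    simp only [weight_two_jacobian_projMap_mulVec hp, hu p hp, cons_add_curl_horizontal,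
      Pi.add_apply, Pi.mul_apply, Matrix.cons_val, infMono, eulerOp, zpow_neg, zpow_ofNat]
    push_cast
    field_simp
    ring
  | 2 =>
    refine (mem_projPullback_congr fun p hp => ?_).2 (Submodule.add_mem _ (Submodule.add_mem _
      (infMono_mul_eulerOp_mem_projPullback (k := k) 0 (-1) 2 0 (-1) 0 0 hq₁ (by omega))
      (infMono_mul_eulerOp_mem_projPullback (k := k) (-1) 0 2 1 0 0 0 hq₂ (by omega)))
      (infMono_mul_eulerOp_mem_projPullback (k := k) 0 0 2 0 0 0 1 hq₃ (by omega)))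
    have hx := hp.1.ne'
    have hy := hp.2.2.1.ne'
    simp only [weight_two_jacobian_projMap_mulVec hp, hu p hp, cons_add_curl_horizontal,
      Pi.add_apply, Pi.mul_apply, Matrix.cons_val, infMono, eulerOp, zpow_neg, zpow_ofNat]
    push_cast
    field_simp
    ring

lemma mulVec_mem_projPullback_of_mem_spaceP_three {u : Proxy 3} (hu : u ∈ spaceP 3 k)
    (i : Fin 1) : (fun p => (weight 3 (jacobian projMap p) *ᵥ u p) i) ∈
      projPullback (conicSpan k (Finset.Iic k)) := by
  obtain ⟨q, hq, hu⟩ := hu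
  have hq' := infMono_mul_eulerOp_mem_projPullback (k := k) 0 0 4 0 0 0 1 hq (by omega)
  refine (mem_projPullback_congr fun p hp => ?_).2 hq'
  simp [hu p hp, weight, det_jacobian_projMap hp, Matrix.mulVec, dotProduct, infMono, eulerOp]

lemma mulVec_mem_projPullback_of_mem_spaceP (s : Fin 4) {u : Proxy s} (hu : u ∈ spaceP s k)
    (i : Fin (proxyDim s)) : (fun p => (weight s (jacobian projMap p) *ᵥ u p) i) ∈
      projPullback (conicSpan k (Finset.Iic k)) := by
  match s with
  | 0 => exact mulVec_mem_projPullback_of_mem_spaceP_zero hu i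
  | 1 => exact mulVec_mem_projPullback_of_mem_spaceP_one hu i
  | 2 => exact mulVec_mem_projPullback_of_mem_spaceP_two hu i
  | 3 => exact mulVec_mem_projPullback_of_mem_spaceP_three hu i

end ShapeFunctions

/-! ### Transfer to affine pyramids -/

lemma isUnit_det_weight (s : Fin 4) {J : Matrix (Fin 3) (Fin 3) ℝ} (hJ : J.det ≠ 0) :
    IsUnit (weight s J).det := by
  rw [isUnit_iff_ne_zero]
  match s with
  | 0 => simp [weight]
  | 1 => simpa [weight, Matrix.det_nonsing_inv] using hJ
  | 2 => simpa [weight, Matrix.det_smul] using hJ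
  | 3 => simpa [weight] using hJ

lemma weight_mulVec_changeCoords (s : Fin 4) {φ : R3 → R3} {x : R3} (h : (jacobian φ x).det ≠ 0)
    (u : Proxy s) : weight s (jacobian φ x) *ᵥ changeCoords s φ u x = u (φ x) := by
  rw [changeCoords, Matrix.mulVec_mulVec, Matrix.mul_nonsing_inv _ (isUnit_det_weight s h),
    Matrix.one_mulVec]

lemma weightedQ_le_projPullback (r : ℕ) :
    weightedQ r (r + 1) (r + 1) 0 ≤ projPullback (conicSpan (r + 1) {r}) := by
  refine Submodule.span_le.2 ?_
  rintro _ ⟨a, b, c, ha, hb, hc, rfl⟩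
  obtain rfl : c = 0 := Nat.le_zero.1 hc
  have hmono : (fun p : R3 => p 0 ^ a * p 1 ^ b * p 2 ^ 0 / (1 + p 2) ^ r) = infMono a b (-r) := by
    ext p
    simp [infMono, div_eq_mul_inv]
  rw [hmono]
  exact infMono_mem_projPullback_conicSpan ha hb (Finset.mem_singleton_self r)

section Components

variable {s : Fin 4} {k r : ℕ} {φK : R3 ≃ᵃ[ℝ] R3}

lemma exists_conicSpan_eqOn_of_mem_approxP {u : Proxy s} (hu : u ∈ approxP s k φK)
    (i : Fin (proxyDim s)) : ∃ h ∈ conicSpan k (Finset.Iic k),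
      EqOn (fun x => changeCoords s φK u x i) h refPyramid := by
  refine exists_eqOn_of_comp_projMap_mem ((mem_projPullback_congr fun p hp => ?_).1
    (mulVec_mem_projPullback_of_mem_spaceP s hu.2 i))
  have hdet : (jacobian projMap p).det ≠ 0 := by
    rw [det_jacobian_projMap hp]
    exact inv_ne_zero (pow_ne_zero _ (one_add_pos_of_mem_infPyramid hp).ne')
  exact congrFun (weight_mulVec_changeCoords s hdet _) i

lemma exists_conicSpan_eqOn_of_mem_approxX {v : Proxy s} (hv : v ∈ approxX s r k φK)
    (i : Fin (proxyDim s)) : ∃ h ∈ conicSpan (r + 1) {r},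
      EqOn (fun x => changeCoords s φK v x i) h refPyramid := by
  obtain ⟨q, hq, hvq⟩ := hv.2 i
  exact exists_eqOn_of_comp_projMap_mem
    ((mem_projPullback_congr hvq).2 (weightedQ_le_projPullback r hq))

end Components

lemma jacobian_affineEquiv (φK : R3 ≃ᵃ[ℝ] R3) (x : R3) :
    jacobian φK x = LinearMap.toMatrix' (φK.linear : R3 →ₗ[ℝ] R3) := by
  ext i j
  rw [jacobian, (hasFDerivAt_affineEquiv φK x).fderiv, LinearMap.toMatrix'_apply]
  rfl

lemma det_jacobian_affineEquiv_ne_zero (φK : R3 ≃ᵃ[ℝ] R3) (x : R3) :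
    (jacobian φK x).det ≠ 0 := by
  rw [jacobian_affineEquiv, LinearMap.det_toMatrix']
  exact det_linear_ne_zero φK

lemma err_eq_jacDet_mul_errRef (k : ℕ) (φK : R3 ≃ᵃ[ℝ] R3) (f : R3 → ℝ) :
    err k φK f = jacDet φK * errRef k (f ∘ φK) := by
  rw [← errRef_smul, err, quad, errRef, affinePyramid,
    setIntegral_image_affineEquiv φK refPyramid_isOpen.measurableSet, ← integral_const_mul]
  rfl

section TensorApply

variable {s : Fin 4}

lemma tensorApply_eq_dotProduct_mulVec (A : Tensor s) (v w : Proxy s) (x : R3) :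
    tensorApply A v w x = v x ⬝ᵥ A x *ᵥ w x := by
  simp only [tensorApply, dotProduct, Matrix.mulVec, Finset.mul_sum, mul_assoc, mul_left_comm]

lemma tensorApply_comp_affineEquiv (φK : R3 ≃ᵃ[ℝ] R3) (A : Tensor s) (v w : Proxy s) :
    tensorApply A v w ∘ φK = tensorApply (tensorChangeCoords s φK A) (changeCoords s φK v)
      (changeCoords s φK w) := by
  ext x
  have hdet := det_jacobian_affineEquiv_ne_zero φK x
  rw [Function.comp_apply, tensorApply_eq_dotProduct_mulVec, tensorApply_eq_dotProduct_mulVec,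
    ← weight_mulVec_changeCoords s hdet v, ← weight_mulVec_changeCoords s hdet w,
    tensorChangeCoords, ← Matrix.mulVec_mulVec, ← Matrix.mulVec_mulVec,
    Matrix.dotProduct_mulVec _ (weight s (jacobian φK x))ᵀ, Matrix.vecMul_transpose]

lemma tensorChangeCoords_affineEquiv_apply (φK : R3 ≃ᵃ[ℝ] R3) (A : Tensor s)
    (i j : Fin (proxyDim s)) : (fun x => tensorChangeCoords s φK A x i j) =
      ∑ b, ∑ a, (weight s (LinearMap.toMatrix' (φK.linear : R3 →ₗ[ℝ] R3)) a i *
        weight s (LinearMap.toMatrix' (φK.linear : R3 →ₗ[ℝ] R3)) b j) •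
          ((fun x => A x a b) ∘ φK) := by
  ext x
  simp only [tensorChangeCoords, jacobian_affineEquiv, Matrix.mul_apply, Matrix.transpose_apply,
    Finset.sum_apply, Pi.smul_apply, smul_eq_mul, Finset.sum_mul, Function.comp_apply,
    mul_right_comm]

lemma MemWInfTensor.tensorChangeCoords_affineEquiv {m : ℕ} {φK : R3 ≃ᵃ[ℝ] R3} {A : Tensor s}
    (hA : MemWInfTensor m A (affinePyramid φK)) :
    MemWInfTensor m (tensorChangeCoords s φK A) refPyramid := by
  intro i j
  rw [tensorChangeCoords_affineEquiv_apply]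
  refine ⟨MemWInf.sum _ fun b _ => MemWInf.sum _ fun a _ =>
    ((hA a b).1.comp_affineEquiv φK refPyramid_isOpen).const_smul _, ?_⟩
  refine Finset.sum_induction _ (ContinuousOn · refPyramid) (fun _ _ => .add) continuousOn_const
    fun b _ => Finset.sum_induction _ (ContinuousOn · refPyramid) (fun _ _ => .add)
      continuousOn_const fun a _ => ?_
  exact ((hA a b).2.comp (contDiff_affineEquiv (n := 0) φK).continuous.continuousOn
    (mapsTo_image _ _)).const_smul _

lemma errRef_tensorApply (k : ℕ) {A : Tensor s} {v w : Proxy s}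
    (h : ∀ i j, IntegrableOn (fun x => A x i j * v x i * w x j) refPyramid) :
    errRef k (tensorApply A v w) = ∑ i, ∑ j, errRef k fun x => A x i j * v x i * w x j := by
  have hsum : tensorApply A v w = ∑ i, ∑ j, fun x => A x i j * v x i * w x j := by
    ext x
    simp only [tensorApply, Finset.sum_apply]
  rw [hsum, errRef_sum k _ fun i _ => integrable_finsetSum' _ fun j _ => h i j]
  exact Finset.sum_congr rfl fun i _ => errRef_sum k _ fun j _ => h i j

end TensorApply

lemma integrableOn_mul_mul_of_mem_conicSpan {m n n' : ℕ} {D D' : Finset ℕ} {a v w : R3 → ℝ}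
    (ha : MemWInf m a refPyramid) (hac : ContinuousOn a refPyramid) (hv : v ∈ conicSpan n D)
    (hw : w ∈ conicSpan n' D') : IntegrableOn (a * v * w) refPyramid := by
  obtain ⟨_, hB⟩ := ha.exists_abs_le refPyramid_isOpen hac
  obtain ⟨_, hBv⟩ := exists_abs_le_of_mem_conicSpan hv
  obtain ⟨_, hBw⟩ := exists_abs_le_of_mem_conicSpan hw
  exact integrableOn_refPyramid ((hac.mul (contDiffOn_of_mem_conicSpan hv).continuousOn).mul
    (contDiffOn_of_mem_conicSpan hw).continuousOn)
    fun x hx => abs_mul_mul_le (hB x hx) (hBv x hx) (hBw x hx)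

lemma abs_sum_sum_le_mul_sum_mul_sum {ι κ : Type*} [Fintype ι] [Fintype κ] {C : ℝ} (hC : 0 ≤ C)
    {E a : ι → κ → ℝ} {v : ι → ℝ} {w : κ → ℝ} (ha : ∀ i j, 0 ≤ a i j) (hv : ∀ i, 0 ≤ v i)
    (hw : ∀ j, 0 ≤ w j) (h : ∀ i j, |E i j| ≤ C * a i j * v i * w j) :
    |∑ i, ∑ j, E i j| ≤ C * (∑ i, ∑ j, a i j) * (∑ i, v i) * ∑ j, w j := by
  simp only [Finset.mul_sum _ _ C, Finset.sum_mul _ _ (∑ i, v i), Finset.sum_mul _ _ (∑ j, w j)]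
  refine (Finset.abs_sum_le_sum_abs _ _).trans (Finset.sum_le_sum fun i _ => ?_)
  refine (Finset.abs_sum_le_sum_abs _ _).trans (Finset.sum_le_sum fun j _ => (h i j).trans ?_)
  have := ha i j
  have := hw j
  have := Finset.sum_nonneg fun i (_ : i ∈ Finset.univ) => hv i
  gcongr
  · exact Finset.single_le_sum (fun i _ => hv i) (Finset.mem_univ i)
  · exact Finset.single_le_sum (fun j _ => hw j) (Finset.mem_univ j)

theorem exists_abs_errRef_tensorApply_le {k r : ℕ} (hr : r ≤ k) : ∃ C, 0 ≤ C ∧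
    ∀ (s : Fin 4) (A : Tensor s) (v w : Proxy s), MemWInfTensor (k - r + 1) A refPyramid →
      (∀ i, ∃ h ∈ conicSpan (r + 1) {r}, EqOn (fun x => v x i) h refPyramid) →
      (∀ j, ∃ h ∈ conicSpan k (Finset.Iic k), EqOn (fun x => w x j) h refPyramid) →
      |errRef k (tensorApply A v w)| ≤
        C * (∑ i, ∑ j, wInfSeminorm (k - r + 1) (fun x => A x i j) refPyramid) *
          (∑ i, hSeminorm r (fun x => v x i) refPyramid) *
          ∑ j, hSeminorm 0 (fun x => w x j) refPyramid := by
  obtain ⟨C, hC, hest⟩ := exists_abs_errRef_mul_mul_le hr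
  refine ⟨C, hC, fun s A v w hA hv hw => ?_⟩
  choose v' hv' hvv' using hv
  choose w' hw' hww' using hw
  have heq (i j) : EqOn (fun x => A x i j * v x i * w x j)
      ((fun x => A x i j) * v' i * w' j) refPyramid := fun x hx => by
    simp only [Pi.mul_apply, ← hvv' i hx, ← hww' j hx]
  have h_int (i j) : IntegrableOn (fun x => A x i j * v x i * w x j) refPyramid :=
    (integrableOn_congr_fun (heq i j) refPyramid_isOpen.measurableSet).2
      (integrableOn_mul_mul_of_mem_conicSpan (hA i j).1 (hA i j).2 (hv' i) (hw' j))
  rw [errRef_tensorApply k h_int]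
  refine abs_sum_sum_le_mul_sum_mul_sum hC (fun i j => ENNReal.toReal_nonneg)
    (fun i => Real.sqrt_nonneg _) (fun j => Real.sqrt_nonneg _) fun i j => ?_
  rw [errRef_congr k (heq i j), hSeminorm_congr refPyramid_isOpen (hvv' i),
    hSeminorm_congr refPyramid_isOpen (hww' j)]
  exact hest _ _ _ (hA i j).1 (hA i j).2 (hv' i) (hw' j)

theorem exists_abs_err_tensorApply_le {k r : ℕ} (hr : r ≤ k) : ∃ C, 0 ≤ C ∧
    ∀ (s : Fin 4) (φK : R3 ≃ᵃ[ℝ] R3) (v w : Proxy s) (A : Tensor s),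
      v ∈ approxX s r k φK → w ∈ approxP s k φK →
      MemWInfTensor (k - r + 1) A (affinePyramid φK) →
      |err k φK (tensorApply A v w)| ≤ C * jacDet φK * refTensorSeminorm (k - r + 1) φK A *
        refSeminorm r φK v * refSeminorm 0 φK w := by
  obtain ⟨C, hC, hest⟩ := exists_abs_errRef_tensorApply_le hr
  refine ⟨C, hC, fun s φK v w A hv hw hA => ?_⟩
  have hErr := hest s _ _ _ hA.tensorChangeCoords_affineEquiv
    (exists_conicSpan_eqOn_of_mem_approxX hv) (exists_conicSpan_eqOn_of_mem_approxP hw)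
  rw [err_eq_jacDet_mul_errRef, tensorApply_comp_affineEquiv, abs_mul,
    abs_of_pos (jacDet_pos φK)]
  calc _ ≤ _ := mul_le_mul_of_nonneg_left hErr (jacDet_pos φK).le
    _ = _ := by rw [refTensorSeminorm, refSeminorm, refSeminorm]; ring

lemma refTensorSeminorm_nonneg {s : Fin 4} (m : ℕ) (φK : R3 ≃ᵃ[ℝ] R3) (A : Tensor s) :
    0 ≤ refTensorSeminorm m φK A :=
  Finset.sum_nonneg fun _ _ => Finset.sum_nonneg fun _ _ => ENNReal.toReal_nonneg

lemma refSeminorm_nonneg {s : Fin 4} (m : ℕ) (φK : R3 ≃ᵃ[ℝ] R3) (u : Proxy s) :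
    0 ≤ refSeminorm m φK u :=
  Finset.sum_nonneg fun _ _ => Real.sqrt_nonneg _

lemma MemWInfTensor.mono {s : Fin 4} {m n : ℕ} {A : Tensor s} {U : Set R3}
    (hA : MemWInfTensor n A U) (hmn : m ≤ n) : MemWInfTensor m A U :=
  fun i j => ⟨fun α hα => (hA i j).1 α (hα.trans hmn), (hA i j).2⟩

end PyramidFE

open PyramidFE in
theorem mainTheorem5_general (k : ℕ) :
    ∃ C : ℝ, ∀ (s : Fin 4) (r : ℕ), r ≤ k → ∀ (φK : R3 ≃ᵃ[ℝ] R3)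
      (v w : Proxy s) (A : Tensor s),
      v ∈ approxX s r k φK →
      w ∈ approxP s k φK →
      MemWInfTensor (k - r + 1) A (affinePyramid φK) →
      |err k φK (tensorApply A v w)| ≤
        C * jacDet φK * refTensorSeminorm (k - r + 1) φK A *
          refSeminorm r φK v * refSeminorm 0 φK w := by
  choose! C hC h using fun (r : ℕ) (hr : r ≤ k) => exists_abs_err_tensorApply_le hr
  refine ⟨∑ r ∈ Finset.range (k + 1), C r, fun s r hr φK v w A hv hw hA => ?_⟩
  have hC_le : C r ≤ ∑ r ∈ Finset.range (k + 1), C r :=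
    Finset.single_le_sum (fun r hr => hC r (Finset.mem_range_succ_iff.1 hr))
      (Finset.mem_range_succ_iff.2 hr)
  have hJ := (jacDet_pos φK).le
  have hA_nonneg := refTensorSeminorm_nonneg (k - r + 1) φK A
  have hv_nonneg := refSeminorm_nonneg r φK v
  have hw_nonneg := refSeminorm_nonneg 0 φK w
  exact (h r hr s φK v w A hv hw hA).trans (by gcongr)

theorem mainTheorem5 (k : ℕ) :
    ∃ C : ℝ, ∀ (s : Fin 4) (r : ℕ), r ≤ k → ∀ (φK : PyramidFE.R3 ≃ᵃ[ℝ] PyramidFE.R3)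
      (v w : PyramidFE.Proxy s) (A : PyramidFE.Tensor s),
      v ∈ PyramidFE.approxX s r k φK →
      w ∈ PyramidFE.approxP s k φK →
      PyramidFE.MemWInfTensor (k + 1) A (PyramidFE.affinePyramid φK) →
      |PyramidFE.err k φK (PyramidFE.tensorApply A v w)| ≤
        C * PyramidFE.jacDet φK * PyramidFE.refTensorSeminorm (k - r + 1) φK A *
          PyramidFE.refSeminorm r φK v * PyramidFE.refSeminorm 0 φK w := by
  obtain ⟨C, hC⟩ := mainTheorem5_general k
  exact ⟨C, fun s r hr φK v w A hv hw hA => hC s r hr φK v w A hv hw (hA.mono (by omega))⟩
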